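/- Let $\theta\in(0,1)$ be an irrational real number whose continued fraction expansion has bounded partial quotients. For a real number $\zeta$, the irrationality exponent $\mu(\zeta)\in\mathbb{R}\cup\{+\infty\}$ is the supremum of the real numbers $\mu$ such that $|\zeta-p/q|<q^{-\mu}$ has infinitely many solutions in rational numbers $p/q$ (in lowest terms, $q\ge 1$). For $0\le\rho<1$ and $n\ge1$ put $$s_n(\theta,\rho)=\lfloor n\theta+\rho\rfloor-\lfloor (n-1)\theta+\rho\rfloor,\qquad s'_n(\theta,\rho)=\lceil n\theta+\rho\rceil-\lceil (n-1)\theta+\rho\rceil .$$ The Sturmian words of slope $\theta$ are the words $(s_n(\theta,\rho))_{n\ge1}$ and $(s'_n(\theta,\rho))_{n\ge1}$ with $0\le\rho<1$. A Sturmian number of slope $\theta$ is a real number $\sum_{n\ge1}x_n b^{-n}$, where $b\ge2$ is an integer and $(x_n)_{n\ge1}$ is obtained from a Sturmian word of slope $\theta$ by replacing the letters $0$ and $1$ by two distinct digits in $\{0,\dots,b-1\}$. Let $\mathcal{L}(\theta)$ be the set of irrationality exponents of the Sturmian numbers of slope $\theta$ (in all bases $b \ge 2$). For an integer $b\ge2$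 set $$\xi_b(\theta)=(b-1)\sum_{j\ge1}\frac1{b^{\lfloor j/\theta\rfloor}},\qquad \xi_b(\theta,\rho)=(b-1)\sum_{n\ge1}\frac{s_n(\theta,\rho)}{b^n}.$$ Then, for every integer $b\ge2$, the exponent $\mu(\xi_b(\theta))$ is finite and $$\mathcal{L}(\theta)\subset\Bigl[\tfrac53+\tfrac{4\sqrt{10}}{15},\ 1+\mu(\xi_b(\theta))\Bigr].$$ Moreover, there exists an intercept $\rho(\theta)\in[0,1)$, depending only on $\theta$, such that for every integer $b\ge2$ $$\mu(\xi_b(\theta,\rho(\theta)))=1+\mu(\xi_b(\theta)).$$ -/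

import Mathlib

noncomputable section

namespace SturmianSpectrum

/-- The irrationality exponent of a real number `ζ`: the supremum (`⊤` if unbounded) of the real
numbers `μ` such that `|ζ - p / q| < 1 / q ^ μ` holds for infinitely many rational numbers `p / q`
(`q ≥ 1` being the reduced denominator). -/
def irrationalityExponent (ζ : ℝ) : EReal :=
  sSup {x : EReal | ∃ μ : ℝ, x = (μ : EReal) ∧
    {r : ℚ | |ζ - (r : ℝ)| < 1 / ((r.den : ℝ) ^ μ)}.Infinite}

/-- The partial quotients `a₁, a₂, …` of the continued fraction expansion of `θ` are bounded. -/
def HasBoundedPartialQuotients (θ : ℝ) : Prop :=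
  ∃ M : ℝ, ∀ (n : ℕ) (a : ℝ), (GenContFract.of θ).partDens.get? n = some a → a ≤ M

/-- The lower Sturmian word of slope `θ` and intercept `ρ`. Words are indexed from `0`, so the value
at `n` is the letter of rank `n + 1`, that is `⌊(n + 1) θ + ρ⌋ - ⌊n θ + ρ⌋`. -/
def lowerSturmian (θ ρ : ℝ) (n : ℕ) : ℤ :=
  ⌊((n : ℝ) + 1) * θ + ρ⌋ - ⌊(n : ℝ) * θ + ρ⌋

/-- The upper Sturmian word of slope `θ` and intercept `ρ`, indexed from `0`. -/
def upperSturmian (θ ρ : ℝ) (n : ℕ) : ℤ :=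
  ⌈((n : ℝ) + 1) * θ + ρ⌉ - ⌈(n : ℝ) * θ + ρ⌉

/-- `s` is a Sturmian word of slope `θ` over the alphabet `{0, 1}`. -/
def IsSturmianWord (θ : ℝ) (s : ℕ → ℤ) : Prop :=
  ∃ ρ : ℝ, 0 ≤ ρ ∧ ρ < 1 ∧ (s = lowerSturmian θ ρ ∨ s = upperSturmian θ ρ)

/-- `ξ` is a `b`-Sturmian number of slope `θ`: its sequence of base-`b` digits is obtained from a
Sturmian word of slope `θ` by replacing the letters `0` and `1` by two distinct digits `d₀`, `d₁`
in `{0, …, b - 1}`. -/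
def IsSturmianNumber (b : ℕ) (θ ξ : ℝ) : Prop :=
  ∃ (s : ℕ → ℤ) (d₀ d₁ : ℕ), IsSturmianWord θ s ∧ d₀ < b ∧ d₁ < b ∧ d₀ ≠ d₁ ∧
    ξ = ∑' n : ℕ, (if s n = 0 then (d₀ : ℝ) else (d₁ : ℝ)) / (b : ℝ) ^ (n + 1)

/-- The spectrum `𝓛(θ)`: the set of irrationality exponents of the Sturmian numbers of slope `θ`
(in any integer base `b ≥ 2`). -/
def spectrum (θ : ℝ) : Set EReal :=
  {x : EReal | ∃ (b : ℕ) (ξ : ℝ), 2 ≤ b ∧ IsSturmianNumber b θ ξ ∧ x = irrationalityExponent ξ}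

/-- `ξ_b(θ) = (b - 1) ∑_{j ≥ 1} b ^ (-⌊j / θ⌋)`. -/
def xiChar (b : ℕ) (θ : ℝ) : ℝ :=
  ((b : ℝ) - 1) * ∑' j : ℕ, 1 / (b : ℝ) ^ ⌊((j : ℝ) + 1) / θ⌋₊

/-- `ξ_b(θ, ρ) = (b - 1) ∑_{n ≥ 1} s_n(θ, ρ) / b ^ n`. -/
def xi (b : ℕ) (θ ρ : ℝ) : ℝ :=
  ((b : ℝ) - 1) * ∑' n : ℕ, (lowerSturmian θ ρ n : ℝ) / (b : ℝ) ^ (n + 1)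

end SturmianSpectrum

end

/-!
Up to a rational affine map, which preserves irrationality exponents, every Sturmian number of slope
`θ` is of the form `G = ∑ F n / b ^ n` with `F n = ⌊n α + ρ⌋` and `α = ± θ`.

Let `p j / q j` be the convergents of `α`. The difference `F (n + q j) - F n - p j` vanishes except
at the hits of level `j`, where it is a sign depending only on the parity of `j`. If `[u, u + W)`
contains no hit, then replacing `F` from `u` on by a sequence with exact quasi-period `q j` gives a
fraction with denominator about `b ^ L`, `L = u + q j`, at distance about `b ^ (-L - W)` from `G`
(`hasSideApprox_of_quasiPeriod`). Distinct hits of level `j` are at distance at least `q (j + 1)`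
(`gap`), by the law of best approximation.

Upper bounds. The approximations of two consecutive levels lie on opposite sides of `G`, so a given
rational number differs from at least one of them. With `K` the upper limit of `q (j + 1) / q j`,
this yields the upper bound `2 + K` for all intercepts, and `1 + K` for the intercept `0`, for which
the first hit after `0` of level `j` is at `q (j + 1)` or later. The latter bound is attained, so
that `ξ_b(θ)` has exponent `1 + K` (`irrationalityExponent_beattySum_zero`). The bound `2 + K` is
attained for an intercept with infinitely many early hits of long return time `q (j + 1) + q j`
(`long_gap`), at levels where `q (j + 1) / q j` is close to `K`; a Baire category argument gives one
that does not depend on the base (`exists_extremal_intercept`).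

Lower bound. Suppose that `W ≤ lam * L` for all approximations of large level, with
`lam < 2 / 3 + 4 √10 / 15`. Let `t j` be the first hit of level `j`. Comparing the hits of
consecutive levels shows `t (j + 1) = t j + q j` eventually (`QualityBound.first_hit_succ`), and then
`q (j + 1) + q j ≤ lam * t (j + 1)` and `t (j + 1) + q (j + 1) ≤ lam * (q (j + 1) + q j)`, where the
second inequality comes from the quasi-period `q (j + 1) + q j`. These inequalities leave
`2, 1, 1, 2, 1, 1, …` as the only possible sequence of partial quotients, and for this sequence they
fail in the limit (`Admissible.le_lam`).
-/

namespace SturmianSpectrum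

/-! ### Irrationality exponents -/

/-- The rational numbers that approximate `ζ` to order `ν`. -/
def approxSet (ζ ν : ℝ) : Set ℚ :=
  {r : ℚ | |ζ - (r : ℝ)| < 1 / ((r.den : ℝ) ^ ν)}

lemma irrationalityExponent_le {ζ B : ℝ} (h : ∀ ν, B < ν → (approxSet ζ ν).Finite) :
    irrationalityExponent ζ ≤ (B : EReal) := by
  refine sSup_le ?_
  rintro _ ⟨μ, rfl, hμ⟩
  by_contra! hlt
  exact hμ (h μ (by exact_mod_cast hlt))

lemma le_irrationalityExponent_of_infinite {ζ ν : ℝ} (h : (approxSet ζ ν).Infinite) :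
    (ν : EReal) ≤ irrationalityExponent ζ :=
  le_sSup ⟨ν, rfl, h⟩

lemma le_irrationalityExponent {ζ B : ℝ} (hB : 0 < B)
    (h : ∀ ν, 0 < ν → ν < B → (approxSet ζ ν).Infinite) :
    (B : EReal) ≤ irrationalityExponent ζ := by
  by_contra! hlt
  have hlt' : max (irrationalityExponent ζ) ((0 : ℝ) : EReal) < (B : EReal) :=
    max_lt hlt (by exact_mod_cast hB)
  obtain ⟨ν, h1, h2⟩ := EReal.lt_iff_exists_real_btwn.1 hlt'
  have h3 := lt_of_le_of_lt (le_max_left _ _) h1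
  have h4 := lt_of_le_of_lt (le_max_right _ _) h1
  exact absurd (le_irrationalityExponent_of_infinite
    (h ν (by exact_mod_cast h4) (by exact_mod_cast h2))) (not_le.2 h3)

lemma finite_rat_den_le (ζ : ℝ) (N : ℕ) :
    {r : ℚ | r.den ≤ N ∧ |ζ - (r : ℝ)| ≤ 1}.Finite := by
  obtain ⟨M, hM⟩ := exists_nat_gt ((|ζ| + 1) * N)
  refine ((Set.finite_Icc (-(M : ℤ)) M).prod (Set.finite_Iic N)).image
    (fun x : ℤ × ℕ => (x.1 : ℚ) / x.2) |>.subset ?_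
  rintro r ⟨h1, h2⟩
  refine ⟨(r.num, r.den), ⟨?_, h1⟩, Rat.num_div_den r⟩
  have hd : (0 : ℝ) < r.den := by exact_mod_cast r.den_pos
  have hr : |(r : ℝ)| ≤ |ζ| + 1 := by
    have := abs_sub_abs_le_abs_sub (r : ℝ) ζ
    rw [abs_sub_comm] at this
    linarith
  have hn : |(r.num : ℝ)| ≤ M := by
    have e : (r.num : ℝ) = (r : ℝ) * r.den := by
      have := Rat.mul_den_eq_num r
      exact_mod_cast this.symm
    rw [e, abs_mul, abs_of_pos hd]
    have hN : (r.den : ℝ) ≤ N := by exact_mod_cast h1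
    calc |(r : ℝ)| * r.den ≤ (|ζ| + 1) * N := by gcongr
      _ ≤ M := hM.le
  rw [Set.mem_Icc]
  have := abs_le.1 hn
  exact ⟨by exact_mod_cast this.1, by exact_mod_cast this.2⟩

lemma abs_sub_le_one_of_mem_approxSet {ζ ν : ℝ} (hν : 0 ≤ ν) {r : ℚ} (hr : r ∈ approxSet ζ ν) :
    |ζ - (r : ℝ)| ≤ 1 := by
  refine hr.le.trans ?_
  have h1 : (1 : ℝ) ≤ r.den := by exact_mod_cast r.den_pos
  exact div_le_one_of_le₀ (Real.one_le_rpow h1 hν) (by positivity)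

lemma zero_le_irrationalityExponent (x : ℝ) : (0 : EReal) ≤ irrationalityExponent x := by
  refine le_irrationalityExponent_of_infinite (ζ := x) (ν := 0) ?_
  obtain ⟨q, hq1, hq2⟩ := exists_rat_btwn (show x - 1 / 2 < x by linarith)
  refine Set.infinite_of_injective_forall_mem (f := fun n : ℕ => q + 1 / ((n : ℚ) + 2)) ?_ ?_
  · intro m n h
    have h' : (1 : ℚ) / (m + 2) = 1 / (n + 2) := add_left_cancel h
    rw [one_div, one_div, inv_inj] at h'
    exact_mod_cast add_right_cancel h'
  · intro n
    change |x - _| < 1 / _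
    have h1 : (0 : ℝ) < 1 / ((n : ℝ) + 2) := by positivity
    have h2 : 1 / ((n : ℝ) + 2) ≤ 1 / 2 := by
      apply one_div_le_one_div_of_le <;> linarith [(Nat.cast_nonneg n : (0 : ℝ) ≤ n)]
    push_cast
    rw [Real.rpow_zero, abs_lt]
    constructor <;> linarith

lemma irrationalityExponent_affine_le (s t : ℚ) (ht : t ≠ 0) (x : ℝ) :
    irrationalityExponent (s + t * x) ≤ irrationalityExponent x := by
  refine sSup_le ?_
  rintro _ ⟨μ, rfl, hμ⟩
  by_contra! hlt
  obtain hμ0 | hμ0 := le_or_gt μ 0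
  · exact absurd (le_trans (by exact_mod_cast hμ0) (zero_le_irrationalityExponent x)) (not_le.2 hlt)
  have hlt' : max (irrationalityExponent x) ((0 : ℝ) : EReal) < (μ : EReal) :=
    max_lt hlt (by exact_mod_cast hμ0)
  obtain ⟨ν, h1, h2⟩ := EReal.lt_iff_exists_real_btwn.1 hlt'
  have h3 := lt_of_le_of_lt (le_max_left _ _) h1
  have h4 : 0 < ν := by exact_mod_cast lt_of_le_of_lt (le_max_right _ _) h1
  have h5 : ν < μ := by exact_mod_cast h2
  refine absurd (le_irrationalityExponent_of_infinite (ζ := x) (ν := ν) ?_) (not_le.2 h3)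
  set D : ℕ := s.den * (t⁻¹).den with hD
  have hDpos : 0 < D := Nat.mul_pos s.den_pos (t⁻¹).den_pos
  have ht' : (0 : ℝ) < |(t : ℝ)| := abs_pos.2 (by exact_mod_cast ht)
  obtain ⟨N, hN⟩ := Filter.eventually_atTop.1
    (((tendsto_rpow_atTop (sub_pos.2 h5)).comp tendsto_natCast_atTop_atTop).eventually_ge_atTop
      ((D : ℝ) ^ ν / |(t : ℝ)|))
  have hinf := hμ.sdiff (finite_rat_den_le (s + t * x) N)
  have hinj : Function.Injective (fun r : ℚ => (r - s) * t⁻¹) := by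
    intro r₁ r₂ h
    have := mul_right_cancel₀ (inv_ne_zero ht) h
    linarith
  refine (hinf.image hinj.injOn).mono ?_
  rintro _ ⟨r, ⟨hr, hrN⟩, rfl⟩
  have hr1 := abs_sub_le_one_of_mem_approxSet hμ0.le hr
  have hden : N ≤ r.den := by
    by_contra! hc
    exact hrN ⟨hc.le, hr1⟩
  have hNd := hN r.den hden
  have hd : (0 : ℝ) < r.den := by exact_mod_cast r.den_pos
  have hle : ((r - s) * t⁻¹).den ≤ D * r.den := by
    refine Nat.le_of_dvd (Nat.mul_pos hDpos r.den_pos) ?_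
    refine (Rat.mul_den_dvd _ _).trans ?_
    have := Nat.mul_dvd_mul_right (Rat.sub_den_dvd r s) (t⁻¹).den
    refine this.trans (dvd_of_eq ?_)
    rw [hD]; ring
  have hle' : (((r - s) * t⁻¹).den : ℝ) ≤ (D : ℝ) * r.den := by exact_mod_cast hle
  have hpos : (0 : ℝ) < (((r - s) * t⁻¹).den : ℝ) := by exact_mod_cast Rat.den_pos _
  change |x - (((r - s) * t⁻¹ : ℚ) : ℝ)| < _
  have e : x - (((r - s) * t⁻¹ : ℚ) : ℝ) = ((s + t * x) - r) / t := by
    have : (t : ℝ) ≠ 0 := by exact_mod_cast ht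
    push_cast
    field_simp
    ring
  rw [e, abs_div]
  have hr' : |(s + t * x) - (r : ℝ)| < 1 / ((r.den : ℝ) ^ μ) := hr
  calc |(s + t * x) - (r : ℝ)| / |(t : ℝ)| < 1 / ((r.den : ℝ) ^ μ) / |(t : ℝ)| := by gcongr
    _ ≤ 1 / ((D : ℝ) * r.den) ^ ν := by
      rw [div_div]
      apply one_div_le_one_div_of_le (by positivity)
      rw [Real.mul_rpow (by positivity) hd.le]
      have e2 : (r.den : ℝ) ^ μ = (r.den : ℝ) ^ (μ - ν) * (r.den : ℝ) ^ ν := by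
        rw [← Real.rpow_add hd]; ring_nf
      rw [e2]
      have := (div_le_iff₀ ht').1 hNd
      simp only [Function.comp] at this
      calc (D : ℝ) ^ ν * (r.den : ℝ) ^ ν ≤ ((r.den : ℝ) ^ (μ - ν) * |(t : ℝ)|) * (r.den : ℝ) ^ ν := by
            gcongr
        _ = _ := by ring
    _ ≤ _ := by
      apply one_div_le_one_div_of_le (by positivity)
      gcongr

lemma irrationalityExponent_affine (s t : ℚ) (ht : t ≠ 0) (x : ℝ) :
    irrationalityExponent (s + t * x) = irrationalityExponent x := by
  refine le_antisymm (irrationalityExponent_affine_le s t ht x) ?_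
  have h := irrationalityExponent_affine_le (-s * t⁻¹) t⁻¹ (inv_ne_zero ht) (s + t * x)
  have e : (((-s * t⁻¹ : ℚ) : ℝ) + ((t⁻¹ : ℚ) : ℝ) * (s + t * x)) = x := by
    have : (t : ℝ) ≠ 0 := by exact_mod_cast ht
    push_cast
    field_simp
    ring
  rwa [e] at h

/-! ### Irrationality exponents from one-sided approximations -/

/-- There is a fraction `P / Q` whose denominator `Q` has size about `b ^ L` (up to a factor `b` and
a factor `2`), which differs from `G`, lies on the side of `G` prescribed by the sign `s` (below `G`
if `s = 1`, above it if `s = -1`), and satisfies `|Q * G - P| ≤ b / b ^ W`. -/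
def HasSideApprox (b : ℕ) (G : ℝ) (s : ℤ) (L W : ℕ) : Prop :=
  ∃ Q P : ℤ, (b : ℝ) ^ L ≤ 2 * Q ∧ (Q : ℝ) ≤ (b : ℝ) ^ (L + 1) ∧
    0 < s * (Q * G - P) ∧ s * (Q * G - P) * (b : ℝ) ^ W ≤ b

/-- One-sided approximations of order greater than `ν` at arbitrarily small distances give infinitely
many rational solutions: as they differ from `G`, finitely many could not get arbitrarily close. -/
lemma approxSet_infinite {b : ℕ} (hb : 2 ≤ b) {G ν : ℝ} (hν : 0 < ν)
    (h : ∀ N : ℕ, ∃ (s : ℤ) (L W : ℕ), (s = 1 ∨ s = -1) ∧ N ≤ L + W ∧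
      ν * (L + 1) + 2 < (L + W : ℕ) ∧ HasSideApprox b G s L W) :
    (approxSet G ν).Infinite := by
  intro hfin
  have hb1 : (1 : ℝ) < b := by exact_mod_cast hb
  have hb0 : (0 : ℝ) < b := by linarith
  -- A positive lower bound for the distance of `G` to the finitely many solutions.
  obtain ⟨δ, hδ, hδ'⟩ : ∃ δ > 0, ∀ r ∈ approxSet G ν, (r : ℝ) ≠ G → δ ≤ |G - r| := by
    refine Set.Finite.induction_on
      (motive := fun (S : Set ℚ) _ => ∃ δ > 0, ∀ r ∈ S, (r : ℝ) ≠ G → δ ≤ |G - r|)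
      _ hfin ⟨1, one_pos, by simp⟩ ?_
    rintro a S - - ⟨δ, hδ, h⟩
    by_cases ha : (a : ℝ) = G
    · refine ⟨δ, hδ, ?_⟩
      rintro r (rfl | hr) hne
      · exact absurd ha hne
      · exact h r hr hne
    · refine ⟨min δ |G - a|, lt_min hδ (abs_pos.2 (sub_ne_zero.2 (Ne.symm ha))), ?_⟩
      rintro r (rfl | hr) hne
      · exact min_le_right _ _
      · exact (min_le_left _ _).trans (h r hr hne)
  obtain ⟨N, hN⟩ := exists_nat_gt (2 * b / δ)
  obtain ⟨s, L, W, hs, hA, hνA, Q, P, h1, h2, h3, h4⟩ := h N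
  have hQ : (0 : ℝ) < Q := by
    have : (0 : ℝ) < (b : ℝ) ^ L := by positivity
    linarith
  have hQ' : 0 < Q := by exact_mod_cast hQ
  set r : ℚ := (P : ℚ) / Q with hr
  have hrR : (r : ℝ) = (P : ℝ) / Q := by rw [hr]; push_cast; rfl
  have habs : |G - r| * Q = s * (Q * G - P) := by
    have e : |(Q : ℝ) * G - P| = s * (Q * G - P) := by
      rcases hs with rfl | rfl
      · rw [abs_of_pos] <;> push_cast at * <;> linarith
      · rw [abs_of_neg] <;> push_cast at * <;> linarith
    rw [← e, hrR]
    nth_rewrite 2 [← abs_of_pos hQ]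
    rw [← abs_mul]
    congr 1
    field_simp
  have hne : (r : ℝ) ≠ G := by
    intro hc
    rw [hc, sub_self, abs_zero, zero_mul] at habs
    linarith
  have hclose : |G - r| * (b : ℝ) ^ (L + W) ≤ 2 * b := by
    have h5 : |G - r| * (b : ℝ) ^ L * (b : ℝ) ^ W ≤ |G - r| * (2 * Q) * (b : ℝ) ^ W := by gcongr
    rw [pow_add]
    calc |G - r| * ((b : ℝ) ^ L * (b : ℝ) ^ W) ≤ |G - r| * (2 * Q) * (b : ℝ) ^ W := by
          rw [← mul_assoc]; exact h5
      _ = 2 * (|G - r| * Q * (b : ℝ) ^ W) := by ring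
      _ ≤ 2 * b := by rw [habs]; linarith
  have hden : (r.den : ℝ) ≤ (b : ℝ) ^ (L + 1) := by
    refine le_trans ?_ h2
    have hdvd : (r.den : ℤ) ∣ Q := by
      rw [hr, ← Rat.divInt_eq_div]; exact Rat.den_dvd P Q
    exact_mod_cast Int.le_of_dvd hQ' hdvd
  have hd0 : (0 : ℝ) < r.den := by exact_mod_cast r.den_pos
  have hmem : r ∈ approxSet G ν := by
    change |G - (r : ℝ)| < 1 / ((r.den : ℝ) ^ ν)
    rw [lt_div_iff₀ (by positivity)]
    have e1 : (r.den : ℝ) ^ ν ≤ (b : ℝ) ^ (ν * (L + 1)) := by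
      calc (r.den : ℝ) ^ ν ≤ ((b : ℝ) ^ (L + 1)) ^ ν := by gcongr
        _ = (b : ℝ) ^ (ν * (L + 1)) := by
          rw [← Real.rpow_natCast, ← Real.rpow_mul hb0.le]
          push_cast; ring_nf
    have e2 : (b : ℝ) ^ (ν * (L + 1)) * b ^ 2 < (b : ℝ) ^ (L + W) := by
      rw [← Real.rpow_natCast (b : ℝ) (L + W), ← Real.rpow_natCast (b : ℝ) 2,
        ← Real.rpow_add hb0]
      exact Real.rpow_lt_rpow_of_exponent_lt hb1 (by push_cast at hνA ⊢; exact hνA)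
    have hX : (0 : ℝ) < (b : ℝ) ^ (ν * (L + 1)) := Real.rpow_pos_of_pos hb0 _
    have hG : 0 < |G - r| := abs_pos.2 (sub_ne_zero.2 (Ne.symm hne))
    have hb2 : (2 : ℝ) * b ≤ b ^ 2 := by
      have : (2 : ℝ) ≤ b := by exact_mod_cast hb
      nlinarith
    have e3 : |G - r| * ((b : ℝ) ^ (ν * (L + 1)) * b ^ 2) < b ^ 2 := by
      calc _ < |G - r| * (b : ℝ) ^ (L + W) := by gcongr
        _ ≤ _ := hclose.trans hb2
    have e4 : |G - r| * (b : ℝ) ^ (ν * (L + 1)) < 1 := by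
      have : (0 : ℝ) < (b : ℝ) ^ 2 := by positivity
      by_contra! hc
      nlinarith
    exact lt_of_le_of_lt (by gcongr) e4
  have hge := hδ' r hmem hne
  have hbN : (N : ℝ) ≤ (b : ℝ) ^ (L + W) := by
    calc (N : ℝ) ≤ (L + W : ℕ) := by exact_mod_cast hA
      _ ≤ (b : ℝ) ^ (L + W) := by exact_mod_cast (Nat.lt_pow_self (by omega)).le
  have : 2 * b < N * δ := (div_lt_iff₀ hδ).1 hN
  have : (N : ℝ) * δ ≤ (b : ℝ) ^ (L + W) * |G - r| := by gcongr
  linarith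

/-- If at every scale `b ^ T` there are fractions `P / Q` on both sides of `G` with
`|Q * G - P|` smaller than `b ^ (-T)` and `Q` at most about `b ^ (B * T)`, then the irrationality
exponent of `G` is at most `1 + B`. A fraction of denominator about `b ^ T` differs from the
fraction `P / Q` on the other side of `G`, hence is at distance at least `1 / (2 * b ^ T * Q)`. -/
lemma irrationalityExponent_le_of_sideApprox {b : ℕ} (hb : 2 ≤ b) {G B C : ℝ} (hB : 0 ≤ B)
    (h : ∀ (s : ℤ), (s = 1 ∨ s = -1) → ∀ T : ℕ, ∃ L W : ℕ, T + 2 ≤ W ∧ (L : ℝ) ≤ B * T + C ∧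
      HasSideApprox b G s L W) :
    irrationalityExponent G ≤ ((1 + B : ℝ) : EReal) := by
  refine irrationalityExponent_le fun ν hν => ?_
  have hb1 : (1 : ℝ) < b := by exact_mod_cast hb
  have hb0 : (0 : ℝ) < b := by linarith
  set c : ℝ := 2 * ((b : ℝ) ^ B * (b : ℝ) ^ C * b) with hc
  have hc0 : 0 < c := by positivity
  obtain ⟨N, hN⟩ := Filter.eventually_atTop.1
    (((tendsto_rpow_atTop (sub_pos.2 hν)).comp tendsto_natCast_atTop_atTop).eventually_ge_atTop c)
  refine (finite_rat_den_le G N).subset fun r hr => ?_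
  refine ⟨?_, abs_sub_le_one_of_mem_approxSet (by linarith) hr⟩
  by_contra! hlt
  have hNr := hN r.den hlt.le
  simp only [Function.comp] at hNr
  have hd0 : (0 : ℝ) < r.den := by exact_mod_cast r.den_pos
  set T := Nat.clog b r.den with hT
  have hT1 : (r.den : ℝ) ≤ (b : ℝ) ^ T := by exact_mod_cast Nat.le_pow_clog (by omega) _
  have hT2 : (b : ℝ) ^ T ≤ b * r.den := by
    rcases Nat.lt_or_ge 1 r.den with h1 | h1
    · have h2 := Nat.pow_pred_clog_lt_self (b := b) (by omega) h1
      have h3 : 0 < T := Nat.clog_pos (by omega) h1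
      have h4 : b ^ T ≤ b * r.den := by
        calc b ^ T = b * b ^ (T - 1) := by
              rw [← pow_succ']; congr 1; omega
          _ ≤ b * r.den := Nat.mul_le_mul_left _ h2.le
      exact_mod_cast h4
    · have h2 : r.den = 1 := le_antisymm h1 r.den_pos
      have h3 : T = 0 := by rw [hT, h2]; exact Nat.clog_one_right b
      rw [h3, h2]; simp; linarith
  have key : ∃ s : ℤ, (s = 1 ∨ s = -1) ∧ 0 ≤ s * ((r : ℝ) - G) := by
    rcases le_total G r with h1 | h1
    · exact ⟨1, Or.inl rfl, by push_cast; linarith⟩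
    · exact ⟨-1, Or.inr rfl, by push_cast; linarith⟩
  obtain ⟨s, hs, hsr⟩ := key
  obtain ⟨L, W, hW, hL, Q, P, h1, h2, h3, h4⟩ := h s hs T
  have hQ : (0 : ℝ) < Q := by
    have : (0 : ℝ) < (b : ℝ) ^ L := by positivity
    linarith
  -- `Q * r - P` is a nonzero multiple of `1 / r.den`, with the sign of `s`.
  have h5 : 0 < (s : ℝ) * (Q * r - P) := by nlinarith
  have hrR : (r : ℝ) * r.den = r.num := by exact_mod_cast Rat.mul_den_eq_num r
  have h6 : 1 ≤ (s : ℝ) * (Q * r - P) * r.den := by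
    have e : (s : ℝ) * (Q * r - P) * r.den = ((s * (Q * r.num - P * r.den) : ℤ) : ℝ) := by
      push_cast
      rw [← hrR]; ring
    have : 0 < (s : ℝ) * (Q * r - P) * r.den := by positivity
    rw [e] at this ⊢
    exact_mod_cast this
  have h7 : (s : ℝ) * (Q * G - P) * r.den ≤ 1 / 2 := by
    have e1 : (b : ℝ) ^ (T + 2) ≤ (b : ℝ) ^ W := pow_le_pow_right₀ hb1.le hW
    have e2 : (s : ℝ) * (Q * G - P) * (b : ℝ) ^ (T + 2) ≤ b := le_trans (by gcongr) h4
    have e3 : (s : ℝ) * (Q * G - P) * (r.den * (b * b)) ≤ b := by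
      refine le_trans ?_ e2
      rw [pow_add, pow_two]
      gcongr
    have e4 : (s : ℝ) * (Q * G - P) * r.den * b ≤ 1 := by
      by_contra! hcon
      nlinarith
    have : (2 : ℝ) ≤ b := by exact_mod_cast hb
    have : 0 < (s : ℝ) * (Q * G - P) * r.den := by positivity
    nlinarith
  have h8 : |G - r| = s * (r - G) := by
    rcases hs with rfl | rfl
    · rw [abs_sub_comm, abs_of_nonneg] <;> push_cast at * <;> linarith
    · rw [abs_of_nonneg] <;> push_cast at * <;> linarith
  have h9 : 1 / 2 ≤ |G - r| * Q * r.den := by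
    rw [h8]; nlinarith
  have hr' : |G - r| * (r.den : ℝ) ^ ν < 1 := (lt_div_iff₀ (by positivity)).1 hr
  have hQle : (Q : ℝ) ≤ (b : ℝ) ^ B * (b : ℝ) ^ C * b * (r.den : ℝ) ^ B := by
    have e1 : (b : ℝ) ^ L ≤ ((b : ℝ) ^ T) ^ B * (b : ℝ) ^ C := by
      rw [← Real.rpow_natCast, ← Real.rpow_natCast, ← Real.rpow_mul hb0.le, ← Real.rpow_add hb0]
      exact Real.rpow_le_rpow_of_exponent_le hb1.le (by linarith)
    have e2 : ((b : ℝ) ^ T) ^ B ≤ (b : ℝ) ^ B * (r.den : ℝ) ^ B := by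
      rw [← Real.mul_rpow hb0.le hd0.le]
      gcongr
    calc (Q : ℝ) ≤ (b : ℝ) ^ L * b := by rw [← pow_succ]; exact h2
      _ ≤ ((b : ℝ) ^ B * (r.den : ℝ) ^ B * (b : ℝ) ^ C) * b := by
        gcongr
        exact e1.trans (by gcongr)
      _ = _ := by ring
  have h10 : 1 ≤ |G - r| * (c * (r.den : ℝ) ^ (1 + B)) := by
    have e : (r.den : ℝ) ^ (1 + B) = r.den * (r.den : ℝ) ^ B := by
      rw [Real.rpow_add hd0, Real.rpow_one]
    rw [e, hc]
    have : |G - r| * Q * r.den ≤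
        |G - r| * ((b : ℝ) ^ B * (b : ℝ) ^ C * b * (r.den : ℝ) ^ B) * r.den := by gcongr
    nlinarith
  have h11 : c * (r.den : ℝ) ^ (1 + B) ≤ (r.den : ℝ) ^ ν := by
    have e : (r.den : ℝ) ^ ν = (r.den : ℝ) ^ (ν - (1 + B)) * (r.den : ℝ) ^ (1 + B) := by
      rw [← Real.rpow_add hd0]; ring_nf
    rw [e]
    gcongr
  have : |G - r| * (c * (r.den : ℝ) ^ (1 + B)) ≤ |G - r| * (r.den : ℝ) ^ ν := by gcongr
  linarith

/-! ### Approximations of a power series from quasi-periods of its coefficients -/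

/-- If `F (n + v) - F n - p` takes only the values `0` and `s`, and vanishes for
`u ≤ n < u + W`, then `∑ F n / b ^ n` is close to the fraction whose coefficients satisfy
`F (n + v) = F n + p` for all `n ≥ u`. Its denominator divides `(b - 1) b ^ u (b ^ v - 1)`, and the
side on which it lies is governed by `s`. -/
lemma hasSideApprox_of_quasiPeriod {b : ℕ} (hb : 2 ≤ b) {F : ℕ → ℤ}
    (hF : Summable fun n => (F n : ℝ) / (b : ℝ) ^ n) {s p : ℤ} {v u W : ℕ} (hv : 1 ≤ v)
    (hd : ∀ n, s * (F (n + v) - F n - p) = 0 ∨ s * (F (n + v) - F n - p) = 1)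
    (h0 : ∀ i < W, s * (F (u + i + v) - F (u + i) - p) = 0)
    (hex : ∃ n, u ≤ n ∧ s * (F (n + v) - F n - p) = 1) :
    HasSideApprox b (∑' n, (F n : ℝ) / (b : ℝ) ^ n) s (u + v) W := by
  have hb2 : (2 : ℝ) ≤ b := by exact_mod_cast hb
  have hb1 : (1 : ℝ) < b := by linarith
  have hb0 : (0 : ℝ) < b := by linarith
  set G := ∑' n, (F n : ℝ) / (b : ℝ) ^ n with hG
  have hsh : ∀ k, Summable fun i => (F (i + k) : ℝ) / (b : ℝ) ^ i := by
    intro k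
    have := ((summable_nat_add_iff k).2 hF).mul_left ((b : ℝ) ^ k)
    refine this.congr fun i => ?_
    rw [pow_add]; field_simp
  have hshift : ∀ k, (b : ℝ) ^ k * G =
      ((∑ i ∈ Finset.range k, F i * (b : ℤ) ^ (k - i) : ℤ) : ℝ) +
        ∑' i, (F (i + k) : ℝ) / (b : ℝ) ^ i := by
    intro k
    rw [hG, ← hF.sum_add_tsum_nat_add k, mul_add, Finset.mul_sum, ← tsum_mul_left]
    congr 1
    · push_cast
      refine Finset.sum_congr rfl fun i hi => ?_
      have : k = (k - i) + i := by have := Finset.mem_range.1 hi; omega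
      nth_rewrite 1 [this]
      rw [pow_add]; field_simp
    · refine tsum_congr fun i => ?_
      rw [pow_add]; field_simp
  have hgeo : HasSum (fun i : ℕ => 1 / (b : ℝ) ^ i) (b / (b - 1)) := by
    have h := hasSum_geometric_of_lt_one (r := (b : ℝ)⁻¹) (by positivity) (inv_lt_one_of_one_lt₀ hb1)
    have e : (1 - (b : ℝ)⁻¹)⁻¹ = b / (b - 1) := by
      have : (b : ℝ) - 1 ≠ 0 := by linarith
      field_simp
    rw [e] at h
    simpa [one_div] using h
  set g : ℕ → ℤ := fun i => s * (F (u + i + v) - F (u + i) - p) with hg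
  have hg01 : ∀ i, g i = 0 ∨ g i = 1 := fun i => hd (u + i)
  have hg0 : ∀ i, (0 : ℝ) ≤ g i := fun i => by
    rcases hg01 i with h | h <;> rw [h] <;> norm_num
  have hg1 : ∀ i, (g i : ℝ) ≤ 1 := fun i => by
    rcases hg01 i with h | h <;> rw [h] <;> norm_num
  have hgs : Summable fun i => (g i : ℝ) / (b : ℝ) ^ i := by
    refine Summable.of_nonneg_of_le (fun i => div_nonneg (hg0 i) (by positivity)) (fun i => ?_)
      hgeo.summable
    gcongr; exact hg1 i
  have hval : (s : ℝ) * (((b : ℝ) - 1) * ((b : ℝ) ^ (u + v) * G - (b : ℝ) ^ u * G -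
      ((∑ i ∈ Finset.range (u + v), F i * (b : ℤ) ^ (u + v - i) : ℤ) : ℝ) +
      ((∑ i ∈ Finset.range u, F i * (b : ℤ) ^ (u - i) : ℤ) : ℝ)) - p * b) =
      (b - 1) * ∑' i, (g i : ℝ) / (b : ℝ) ^ i := by
    rw [hshift (u + v), hshift u]
    have e : ∑' i, (g i : ℝ) / (b : ℝ) ^ i = s * (∑' i, (F (i + (u + v)) : ℝ) / (b : ℝ) ^ i -
        ∑' i, (F (i + u) : ℝ) / (b : ℝ) ^ i - p * (b / (b - 1))) := by
      rw [← (hsh (u + v)).tsum_sub (hsh u), ← hgeo.tsum_eq, ← tsum_mul_left,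
        ← ((hsh (u + v)).sub (hsh u)).tsum_sub (hgeo.summable.mul_left _), ← tsum_mul_left]
      refine tsum_congr fun i => ?_
      simp only [hg]
      rw [show u + i + v = i + (u + v) by ring, show u + i = i + u by ring]
      push_cast
      ring
    rw [e]
    have : (b : ℝ) - 1 ≠ 0 := by linarith
    field_simp
    ring
  refine ⟨((b : ℤ) - 1) * (b ^ u * (b ^ v - 1)),
    ((b : ℤ) - 1) * ((∑ i ∈ Finset.range (u + v), F i * (b : ℤ) ^ (u + v - i)) -
      ∑ i ∈ Finset.range u, F i * (b : ℤ) ^ (u - i)) + p * b, ?_, ?_, ?_⟩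
  · have h1 : (2 : ℝ) ≤ (b : ℝ) ^ v := by
      calc (2 : ℝ) ≤ b := hb2
        _ = (b : ℝ) ^ 1 := (pow_one _).symm
        _ ≤ (b : ℝ) ^ v := pow_le_pow_right₀ hb1.le hv
    push_cast
    have h2 : (b : ℝ) ^ u * (b ^ v - 1) * 1 ≤ (b : ℝ) ^ u * (b ^ v - 1) * (b - 1) := by
      apply mul_le_mul_of_nonneg_left (by linarith)
      exact mul_nonneg (by positivity) (by linarith)
    have h3 : (b : ℝ) ^ u * b ^ v ≤ (b : ℝ) ^ u * (2 * (b ^ v - 1)) := by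
      gcongr; linarith
    rw [pow_add]
    linarith
  · push_cast
    have h1 : (1 : ℝ) ≤ (b : ℝ) ^ v := one_le_pow₀ hb1.le
    calc ((b : ℝ) - 1) * (b ^ u * (b ^ v - 1)) ≤ b * (b ^ u * b ^ v) := by
          gcongr <;> linarith
      _ = _ := by rw [pow_succ, pow_add]; ring
  have hval' : (s : ℝ) * (((((b : ℤ) - 1) * (b ^ u * (b ^ v - 1)) : ℤ) : ℝ) * G -
      ((((b : ℤ) - 1) * ((∑ i ∈ Finset.range (u + v), F i * (b : ℤ) ^ (u + v - i)) -
      ∑ i ∈ Finset.range u, F i * (b : ℤ) ^ (u - i)) + p * b : ℤ) : ℝ)) =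
      (b - 1) * ∑' i, (g i : ℝ) / (b : ℝ) ^ i := by
    rw [← hval]
    push_cast
    rw [pow_add]
    ring
  rw [hval']
  constructor
  · refine mul_pos (by linarith) ?_
    obtain ⟨n, hn, hn1⟩ := hex
    refine hgs.tsum_pos (fun i => div_nonneg (hg0 i) (by positivity)) (n - u) ?_
    have : g (n - u) = 1 := by
      simp only [hg]
      rwa [show u + (n - u) = n by omega]
    rw [this]
    positivity
  · rw [← hgs.sum_add_tsum_nat_add W]
    have e1 : ∑ i ∈ Finset.range W, (g i : ℝ) / (b : ℝ) ^ i = 0 := by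
      refine Finset.sum_eq_zero fun i hi => ?_
      have : g i = 0 := h0 i (Finset.mem_range.1 hi)
      rw [this]; simp
    have e2 : ∑' i, (g (i + W) : ℝ) / (b : ℝ) ^ (i + W) ≤ (b / (b - 1)) / (b : ℝ) ^ W := by
      have hs' := hgeo.div_const ((b : ℝ) ^ W)
      rw [← hs'.tsum_eq]
      refine ((summable_nat_add_iff W).2 hgs).tsum_le_tsum (fun i => ?_) hs'.summable
      rw [div_div, ← pow_add]
      gcongr; exact hg1 _
    rw [e1, zero_add]
    have hb' : (0 : ℝ) < b - 1 := by linarith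
    calc _ ≤ ((b : ℝ) - 1) * ((b / (b - 1)) / (b : ℝ) ^ W) * (b : ℝ) ^ W := by gcongr
      _ = b := by field_simp

/-- The inhomogeneous Beatty sequence `⌊n α + ρ⌋`. -/
noncomputable def beatty (α ρ : ℝ) (n : ℕ) : ℤ := ⌊(n : ℝ) * α + ρ⌋

lemma summable_beatty {b : ℕ} (hb : 2 ≤ b) (α ρ : ℝ) :
    Summable fun n => (beatty α ρ n : ℝ) / (b : ℝ) ^ n := by
  have hb1 : (1 : ℝ) < b := by exact_mod_cast hb
  have hr : ‖(b : ℝ)⁻¹‖ < 1 := by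
    rw [Real.norm_of_nonneg (by positivity)]
    exact inv_lt_one_of_one_lt₀ hb1
  have h1 := (summable_pow_mul_geometric_of_norm_lt_one 1 hr).mul_left |α|
  have h0 := (summable_pow_mul_geometric_of_norm_lt_one 0 hr).mul_left (|ρ| + 1)
  refine Summable.of_norm_bounded (h1.add h0) fun n => ?_
  have hF : |(beatty α ρ n : ℝ)| ≤ |α| * n + (|ρ| + 1) := by
    have e1 := Int.floor_le ((n : ℝ) * α + ρ)
    have e2 := Int.lt_floor_add_one ((n : ℝ) * α + ρ)
    have e3 : |(n : ℝ) * α + ρ| ≤ |α| * n + |ρ| := by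
      refine (abs_add_le _ _).trans ?_
      rw [abs_mul, Nat.abs_cast, mul_comm]
    have e4 := abs_le.1 e3
    unfold beatty
    rw [abs_le]
    constructor <;> linarith
  rw [norm_div, Real.norm_eq_abs, norm_pow, Real.norm_of_nonneg (by positivity : (0 : ℝ) ≤ b),
    div_eq_mul_inv, ← inv_pow]
  calc _ ≤ (|α| * n + (|ρ| + 1)) * ((b : ℝ)⁻¹) ^ n := by gcongr
    _ = _ := by ring

/-- The sum `∑ ⌊n α + ρ⌋ / b ^ n`, an affine image of a Sturmian number of slope `α`. -/
noncomputable def beattySum (b : ℕ) (α ρ : ℝ) : ℝ := ∑' n, (beatty α ρ n : ℝ) / (b : ℝ) ^ n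

/-! ### Convergents and the defects of quasi-periods -/

/-- A sequence of convergents `p j / q j` of `α`, lying alternately above and below `α`, with
partial quotients `a j`. The sign of `q j * α - p j` is `s j`. Negating `α` and `p j` reverses all
signs, which is why the sign `s 0` is left free. -/
structure ConvergentSystem (α : ℝ) where
  q : ℕ → ℕ
  p : ℕ → ℤ
  a : ℕ → ℕ
  s : ℕ → ℤ
  q_zero : q 0 = 1
  q_one_pos : 1 ≤ q 1
  a_pos : ∀ j, 1 ≤ a j
  q_rec : ∀ j, q (j + 2) = a j * q (j + 1) + q j
  p_rec : ∀ j, p (j + 2) = a j * p (j + 1) + p j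
  det : p 1 * q 0 - p 0 * q 1 = 1 ∨ p 1 * q 0 - p 0 * q 1 = -1
  s_unit : ∀ j, s j = 1 ∨ s j = -1
  s_succ : ∀ j, s (j + 1) = -s j
  err_pos' : ∀ j, 0 < (s j : ℝ) * (q j * α - p j)
  err_lt_one' : (s 0 : ℝ) * (q 0 * α - p 0) < 1

/-- The defect at `n` of the quasi-period `v` of the sequence `⌊n α + ρ⌋`: the deviation of
`⌊(n + v) α + ρ⌋ - ⌊n α + ρ⌋` from `p`, normalized by a sign `s`. -/
noncomputable def defect (α ρ : ℝ) (s p : ℤ) (v n : ℕ) : ℤ :=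
  s * (beatty α ρ (n + v) - beatty α ρ n - p)

lemma beatty_bounds (α ρ : ℝ) (n : ℕ) :
    (beatty α ρ n : ℝ) ≤ n * α + ρ ∧ (n * α + ρ : ℝ) < beatty α ρ n + 1 :=
  ⟨Int.floor_le _, Int.lt_floor_add_one _⟩

lemma defect_eq_zero_or_one {α ρ : ℝ} {s p : ℤ} {v : ℕ} (hs : s = 1 ∨ s = -1)
    (h0 : 0 < (s : ℝ) * (v * α - p)) (h1 : (s : ℝ) * (v * α - p) < 1) (n : ℕ) :
    defect α ρ s p v n = 0 ∨ defect α ρ s p v n = 1 := by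
  obtain ⟨a1, a2⟩ := beatty_bounds α ρ n
  obtain ⟨b1, b2⟩ := beatty_bounds α ρ (n + v)
  unfold defect
  set X := beatty α ρ n
  set Y := beatty α ρ (n + v)
  push_cast at b1 b2
  rcases hs with rfl | rfl
  · push_cast at h0 h1
    have c1 : (Y : ℝ) < X + p + 2 := by nlinarith
    have c2 : (X : ℝ) + p < Y + 1 := by nlinarith
    have c1' : Y < X + p + 2 := by exact_mod_cast c1
    have c2' : X + p < Y + 1 := by exact_mod_cast c2
    omega
  · push_cast at h0 h1
    have c1 : (Y : ℝ) < X + p + 1 := by nlinarith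
    have c2 : (X : ℝ) + p < Y + 2 := by nlinarith
    have c1' : Y < X + p + 1 := by exact_mod_cast c1
    have c2' : X + p < Y + 2 := by exact_mod_cast c2
    omega

/-- Defects of a quasi-period never stop, as `v * α ≠ p`. -/
lemma exists_defect_eq_one {α ρ : ℝ} {s p : ℤ} {v : ℕ} (hs : s = 1 ∨ s = -1)
    (h0 : 0 < (s : ℝ) * (v * α - p)) (h1 : (s : ℝ) * (v * α - p) < 1) (u : ℕ) :
    ∃ n, u ≤ n ∧ defect α ρ s p v n = 1 := by
  by_contra! hc
  have hz : ∀ n, u ≤ n → beatty α ρ (n + v) = beatty α ρ n + p := by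
    intro n hn
    have := (defect_eq_zero_or_one (ρ := ρ) hs h0 h1 n).resolve_right (hc n hn)
    unfold defect at this
    rcases hs with rfl | rfl <;> omega
  have hk : ∀ k : ℕ, beatty α ρ (u + k * v) = beatty α ρ u + k * p := by
    intro k
    induction k with
    | zero => simp
    | succ k ih =>
      rw [show u + (k + 1) * v = (u + k * v) + v by ring, hz _ (by omega), ih]
      push_cast; ring
  obtain ⟨k, hk'⟩ := exists_nat_gt (1 / ((s : ℝ) * (v * α - p)))
  rw [div_lt_iff₀ h0] at hk'
  obtain ⟨a1, a2⟩ := beatty_bounds α ρ u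
  obtain ⟨b1, b2⟩ := beatty_bounds α ρ (u + k * v)
  rw [hk k] at b1 b2
  push_cast at b1 b2
  rcases hs with rfl | rfl <;> push_cast at hk' <;> nlinarith

/-- At two defects of the same quasi-period, the values of `n α + ρ` modulo `1` lie in one half-open
interval of length `|v α - p|`. -/
lemma abs_sub_lt_of_defect {α ρ : ℝ} {s p : ℤ} {v : ℕ} (hs : s = 1 ∨ s = -1) {m n : ℕ}
    (hm : defect α ρ s p v m = 1) (hn : defect α ρ s p v n = 1) :
    |((n : ℝ) - m) * α - (beatty α ρ n - beatty α ρ m)| < (s : ℝ) * (v * α - p) := by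
  obtain ⟨a1, a2⟩ := beatty_bounds α ρ n
  obtain ⟨b1, b2⟩ := beatty_bounds α ρ (n + v)
  obtain ⟨c1, c2⟩ := beatty_bounds α ρ m
  obtain ⟨d1, d2⟩ := beatty_bounds α ρ (m + v)
  unfold defect at hm hn
  have hm' : beatty α ρ (m + v) = beatty α ρ m + p + s := by rcases hs with rfl | rfl <;> omega
  have hn' : beatty α ρ (n + v) = beatty α ρ n + p + s := by rcases hs with rfl | rfl <;> omega
  rw [hn'] at b1 b2
  rw [hm'] at d1 d2
  push_cast at b1 b2 d1 d2
  rw [abs_lt]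
  rcases hs with rfl | rfl <;> push_cast at * <;> constructor <;> nlinarith

namespace ConvergentSystem

variable {α : ℝ} (S : ConvergentSystem α)

/-- The convergents of `-α`. -/
def neg : ConvergentSystem (-α) where
  q := S.q
  p := fun j => -S.p j
  a := S.a
  s := fun j => -S.s j
  q_zero := S.q_zero
  q_one_pos := S.q_one_pos
  a_pos := S.a_pos
  q_rec := S.q_rec
  p_rec := fun j => by rw [S.p_rec]; ring
  det := by
    have := S.det
    rcases this with h | h
    · right; linarith
    · left; linarith
  s_unit := fun j => by
    rcases S.s_unit j with h | h <;> rw [h] <;> simp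
  s_succ := fun j => by rw [S.s_succ]
  err_pos' := fun j => by
    have := S.err_pos' j
    push_cast
    linarith
  err_lt_one' := by
    have := S.err_lt_one'
    push_cast
    linarith

/-- The distance `|q j * α - p j|`. -/
noncomputable def err (j : ℕ) : ℝ := (S.s j : ℝ) * (S.q j * α - S.p j)

lemma err_pos (j : ℕ) : 0 < S.err j := S.err_pos' j

lemma err_add_two (j : ℕ) : S.err (j + 2) = S.err j - S.a j * S.err (j + 1) := by
  unfold err
  rw [S.q_rec, S.p_rec, S.s_succ (j + 1), S.s_succ j]
  push_cast
  ring

lemma err_succ_lt (j : ℕ) : S.err (j + 1) < S.err j := by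
  have h1 := S.err_add_two j
  have h2 := S.err_pos (j + 2)
  have h3 : (1 : ℝ) ≤ S.a j := by exact_mod_cast S.a_pos j
  have h4 := S.err_pos (j + 1)
  nlinarith

lemma err_lt_one (j : ℕ) : S.err j < 1 := by
  induction j with
  | zero => exact S.err_lt_one'
  | succ j ih => exact (S.err_succ_lt j).trans ih

lemma q_pos (j : ℕ) : 1 ≤ S.q j := by
  induction j using Nat.twoStepInduction with
  | zero => exact S.q_zero.ge
  | one => exact S.q_one_pos
  | more j h1 h2 => rw [S.q_rec]; omega

lemma q_add_le (j : ℕ) : S.q (j + 1) + S.q j ≤ S.q (j + 2) := by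
  rw [S.q_rec]
  have := Nat.mul_le_mul_right (S.q (j + 1)) (S.a_pos j)
  omega

lemma q_le_succ (j : ℕ) : S.q j ≤ S.q (j + 1) := by
  cases j with
  | zero => rw [S.q_zero]; exact S.q_one_pos
  | succ j => exact (Nat.le_add_right _ _).trans (S.q_add_le j)

lemma le_q (j : ℕ) : j ≤ S.q j := by
  induction j using Nat.twoStepInduction with
  | zero => exact Nat.zero_le _
  | one => exact S.q_one_pos
  | more j h1 h2 => have := S.q_add_le j; have := S.q_pos j; omega

lemma q_mono : Monotone S.q := monotone_nat_of_le_succ S.q_le_succ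

lemma det_succ (j : ℕ) : S.p (j + 1) * S.q j - S.p j * S.q (j + 1) = 1 ∨
    S.p (j + 1) * S.q j - S.p j * S.q (j + 1) = -1 := by
  induction j with
  | zero => exact S.det
  | succ j ih =>
    have e : S.p (j + 2) * S.q (j + 1) - S.p (j + 1) * S.q (j + 2) =
        -(S.p (j + 1) * S.q j - S.p j * S.q (j + 1)) := by
      rw [S.q_rec, S.p_rec]; push_cast; ring
    change S.p (j + 2) * S.q (j + 1) - S.p (j + 1) * S.q (j + 2) = 1 ∨
      S.p (j + 2) * S.q (j + 1) - S.p (j + 1) * S.q (j + 2) = -1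
    rw [e]
    rcases ih with h | h <;> rw [h] <;> simp

lemma err_mul_q_lt_one (j : ℕ) : S.err j * S.q (j + 1) < 1 := by
  have e : (S.s j : ℝ) * (S.err j * S.q (j + 1) + S.err (j + 1) * S.q j) =
      S.p (j + 1) * S.q j - S.p j * S.q (j + 1) := by
    unfold err
    rw [S.s_succ]
    rcases S.s_unit j with h | h <;> rw [h] <;> push_cast <;> ring
  have h1 : (0 : ℝ) < S.q j := by exact_mod_cast S.q_pos j
  have h2 := mul_pos (S.err_pos (j + 1)) h1
  have h3 : (S.p (j + 1) * S.q j - S.p j * S.q (j + 1) : ℝ) ≤ 1 ∧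
      (-1 : ℝ) ≤ S.p (j + 1) * S.q j - S.p j * S.q (j + 1) := by
    rcases S.det_succ j with h | h
    · have h' : (S.p (j + 1) * S.q j - S.p j * S.q (j + 1) : ℝ) = 1 := by exact_mod_cast h
      rw [h']; norm_num
    · have h' : (S.p (j + 1) * S.q j - S.p j * S.q (j + 1) : ℝ) = -1 := by exact_mod_cast h
      rw [h']; norm_num
  rw [← e] at h3
  rcases S.s_unit j with h | h <;> rw [h] at h3 <;> push_cast at h3 <;> linarith

/-- The law of best approximation, with signs: for `0 < m < q (j + 1)` the number `m α - k` is at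
least `err j` on the side of `q j * α - p j`, or at least `err j + err (j + 1)` on the other
side. -/
lemma best_approximation (j : ℕ) {m k : ℤ} (hm : 0 < m) (hm' : m < S.q (j + 1)) :
    S.err j ≤ (S.s j : ℝ) * (m * α - k) ∨
      (S.s j : ℝ) * (m * α - k) ≤ -S.err j - S.err (j + 1) := by
  -- Coordinates of `(m, k)` in the unimodular basis `(q j, p j)`, `(q (j + 1), p (j + 1))`.
  obtain ⟨x, y, hx, hy⟩ : ∃ x y : ℤ, m = x * S.q j + y * S.q (j + 1) ∧
      k = x * S.p j + y * S.p (j + 1) := by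
    rcases S.det_succ j with h | h
    · refine ⟨m * S.p (j + 1) - k * S.q (j + 1), k * S.q j - m * S.p j, ?_, ?_⟩
      · linear_combination (-m) * h
      · linear_combination (-k) * h
    · refine ⟨-(m * S.p (j + 1) - k * S.q (j + 1)), -(k * S.q j - m * S.p j), ?_, ?_⟩
      · linear_combination m * h
      · linear_combination k * h
  have e : (S.s j : ℝ) * (m * α - k) = x * S.err j - y * S.err (j + 1) := by
    unfold err
    rw [hx, hy, S.s_succ]
    push_cast
    ring
  rw [e]
  have hq := S.q_pos j
  have hq' := S.q_pos (j + 1)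
  have e1 := S.err_pos j
  have e2 := S.err_pos (j + 1)
  rcases le_or_gt y 0 with hy0 | hy0
  · left
    have hx1 : 1 ≤ x := by
      by_contra! hc
      have : x * S.q j ≤ 0 := mul_nonpos_of_nonpos_of_nonneg (by omega) (by omega)
      have : y * S.q (j + 1) ≤ 0 := mul_nonpos_of_nonpos_of_nonneg (by omega) (by omega)
      omega
    have hx1' : (1 : ℝ) ≤ x := by exact_mod_cast hx1
    have hy0' : (y : ℝ) ≤ 0 := by exact_mod_cast hy0
    nlinarith
  · right
    have hx1 : x ≤ -1 := by
      by_contra! hc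
      have : 0 ≤ x * S.q j := mul_nonneg (by omega) (by omega)
      have : (S.q (j + 1) : ℤ) ≤ y * S.q (j + 1) := by nlinarith
      omega
    have hx1' : (x : ℝ) ≤ -1 := by exact_mod_cast hx1
    have hy0' : (1 : ℝ) ≤ y := by exact_mod_cast hy0
    nlinarith

/-! ### Defects of the convergent quasi-periods -/

/-- The defect at `n` of the quasi-period `q j`. It equals `1` (and `n` is called a hit of level
`j`) if `n α + ρ` modulo `1` lies in a half-open interval of length `err j` adjacent to `0`, and `0`
otherwise. -/
noncomputable def chi (ρ : ℝ) (j n : ℕ) : ℤ := defect α ρ (S.s j) (S.p j) (S.q j) n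

/-- The defect at `n` of the quasi-period `q (j + 1) + q j`. -/
noncomputable def psi (ρ : ℝ) (j n : ℕ) : ℤ :=
  defect α ρ (S.s j) (S.p (j + 1) + S.p j) (S.q (j + 1) + S.q j) n

variable (ρ : ℝ)

lemma chi_eq (j n : ℕ) : S.chi ρ j n = 0 ∨ S.chi ρ j n = 1 :=
  defect_eq_zero_or_one (S.s_unit j) (S.err_pos j) (S.err_lt_one j) n

lemma psi_err (j : ℕ) : 0 < (S.s j : ℝ) * ((S.q (j + 1) + S.q j : ℕ) * α -
    (S.p (j + 1) + S.p j : ℤ)) ∧ (S.s j : ℝ) * ((S.q (j + 1) + S.q j : ℕ) * α -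
    (S.p (j + 1) + S.p j : ℤ)) < 1 := by
  have e : (S.s j : ℝ) * ((S.q (j + 1) + S.q j : ℕ) * α - (S.p (j + 1) + S.p j : ℤ)) =
      S.err j - S.err (j + 1) := by
    unfold err
    rw [S.s_succ]
    push_cast
    ring
  rw [e]
  have h1 := S.err_succ_lt j
  have h2 := S.err_lt_one j
  have h3 := S.err_pos (j + 1)
  constructor <;> linarith

lemma psi_eq (j n : ℕ) : S.psi ρ j n = 0 ∨ S.psi ρ j n = 1 :=
  defect_eq_zero_or_one (S.s_unit j) (S.psi_err j).1 (S.psi_err j).2 n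

lemma psi_eq_chi_add_sub (j n : ℕ) :
    S.psi ρ j n = S.chi ρ j (n + S.q (j + 1)) - S.chi ρ (j + 1) n := by
  unfold psi chi defect
  rw [S.s_succ, ← add_assoc]
  ring

lemma psi_eq_chi_sub_add (j n : ℕ) :
    S.psi ρ j n = S.chi ρ j n - S.chi ρ (j + 1) (n + S.q j) := by
  unfold psi chi defect
  rw [S.s_succ, show n + (S.q (j + 1) + S.q j) = n + S.q j + S.q (j + 1) by ring]
  ring

variable {ρ}

/-- Distinct hits of level `j` are at distance at least `q (j + 1)`. -/
lemma gap {j m n : ℕ} (hm : S.chi ρ j m = 1) (hn : S.chi ρ j n = 1) (h : m < n) :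
    m + S.q (j + 1) ≤ n := by
  by_contra! hc
  have h1 := abs_lt.1 (abs_sub_lt_of_defect (S.s_unit j) hm hn)
  have h2 := S.best_approximation j (m := (n : ℤ) - m) (k := beatty α ρ n - beatty α ρ m)
    (by omega) (by omega)
  have e1 := S.err_pos (j + 1)
  have e : (S.s j : ℝ) * (S.q j * α - S.p j) = S.err j := rfl
  rw [e] at h1
  push_cast at h2
  rcases S.s_unit j with h | h <;> rw [h] at h2 <;> push_cast at h2 <;>
    rcases h2 with h2 | h2 <;> linarith

lemma hit_of_hit_succ {j n : ℕ} (h : S.chi ρ (j + 1) (n + S.q j) = 1) : S.chi ρ j n = 1 := by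
  have h1 := S.psi_eq_chi_sub_add ρ j n
  rcases S.psi_eq ρ j n with h2 | h2 <;> rcases S.chi_eq ρ j n with h3 | h3 <;> omega

lemma hit_add_of_hit_succ {j n : ℕ} (h : S.chi ρ (j + 1) n = 1) :
    S.chi ρ j (n + S.q (j + 1)) = 1 := by
  have h1 := S.psi_eq_chi_add_sub ρ j n
  rcases S.psi_eq ρ j n with h2 | h2 <;>
    rcases S.chi_eq ρ j (n + S.q (j + 1)) with h3 | h3 <;> omega

lemma hit_succ_or_hit {j n : ℕ} (h : S.chi ρ j n = 1) :
    S.chi ρ (j + 1) (n + S.q j) = 1 ∨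
      (S.chi ρ (j + 1) n = 0 ∧ S.chi ρ j (n + S.q (j + 1)) = 1) := by
  have h1 := S.psi_eq_chi_sub_add ρ j n
  have h2 := S.psi_eq_chi_add_sub ρ j n
  rcases S.chi_eq ρ (j + 1) (n + S.q j) with h3 | h3
  · right
    rcases S.chi_eq ρ j (n + S.q (j + 1)) with h4 | h4 <;>
      rcases S.chi_eq ρ (j + 1) n with h5 | h5 <;> omega
  · exact Or.inl h3

/-- A hit `n` of level `j` followed by the hit `n + q j` of level `j + 1` has a long return time. -/
lemma long_gap {j m n : ℕ} (hn : S.chi ρ (j + 1) (n + S.q j) = 1) (hm : S.chi ρ j m = 1)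
    (h : n < m) : n + S.q (j + 1) + S.q j ≤ m := by
  have h1 := S.gap (S.hit_of_hit_succ hn) hm h
  obtain ⟨k, rfl⟩ : ∃ k, m = k + S.q (j + 1) := ⟨m - S.q (j + 1), by omega⟩
  have h2 := S.psi_eq_chi_add_sub ρ j k
  have h3 := S.psi_eq_chi_sub_add ρ j k
  have hq := S.q_le_succ j
  have hq2 := S.q_add_le j
  have hq1 := S.q_pos (j + 1)
  rcases S.chi_eq ρ (j + 1) k with h4 | h4
  · have h5 : S.chi ρ j k = 1 := by
      rcases S.chi_eq ρ j k with h6 | h6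
      · rcases S.chi_eq ρ (j + 1) (k + S.q j) with h7 | h7 <;> omega
      · exact h6
    rcases Nat.lt_or_ge n k with h6 | h6
    · have := S.gap (S.hit_of_hit_succ hn) h5 h6
      omega
    · obtain rfl : k = n := by omega
      omega
  · by_contra! hc
    have := S.gap h4 hn (by omega)
    have e : S.q (j + 1 + 1) = S.q (j + 2) := rfl
    omega

lemma exists_hit (ρ : ℝ) (j u : ℕ) : ∃ n, u ≤ n ∧ S.chi ρ j n = 1 :=
  exists_defect_eq_one (S.s_unit j) (S.err_pos j) (S.err_lt_one j) u

/-- The first hit of level `j`. -/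
lemma exists_first_hit (ρ : ℝ) (j : ℕ) : ∃ t, S.chi ρ j t = 1 ∧ ∀ n, S.chi ρ j n = 1 → t ≤ n := by
  classical
  have h : ∃ n, S.chi ρ j n = 1 := by
    obtain ⟨n, -, hn⟩ := S.exists_hit ρ j 0
    exact ⟨n, hn⟩
  exact ⟨Nat.find h, Nat.find_spec h, fun n hn => Nat.find_min' h hn⟩

lemma hasSideApprox {b : ℕ} (hb : 2 ≤ b) {j u W : ℕ}
    (h : ∀ n, u ≤ n → S.chi ρ j n = 1 → u + W ≤ n) :
    HasSideApprox b (beattySum b α ρ) (S.s j) (u + S.q j) W := by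
  refine hasSideApprox_of_quasiPeriod hb (summable_beatty hb α ρ) (p := S.p j) (S.q_pos j)
    (S.chi_eq ρ j) (fun i hi => ?_) (S.exists_hit ρ j u)
  refine (S.chi_eq ρ j (u + i)).resolve_right fun hc => ?_
  have := h (u + i) (by omega) hc
  omega

lemma hasSideApprox_psi {b : ℕ} (hb : 2 ≤ b) {j u W : ℕ}
    (h : ∀ n, u ≤ n → S.psi ρ j n = 1 → u + W ≤ n) :
    HasSideApprox b (beattySum b α ρ) (S.s j) (u + (S.q (j + 1) + S.q j)) W := by
  refine hasSideApprox_of_quasiPeriod hb (summable_beatty hb α ρ) (p := S.p (j + 1) + S.p j)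
    ((S.q_pos j).trans (Nat.le_add_left _ _)) (S.psi_eq ρ j) (fun i hi => ?_)
    (exists_defect_eq_one (S.s_unit j) (S.psi_err j).1 (S.psi_err j).2 u)
  refine (S.psi_eq ρ j (u + i)).resolve_right fun hc => ?_
  have := h (u + i) (by omega) hc
  omega

lemma exists_of_hit {j n : ℕ} (h : S.chi ρ j n = 1) :
    ∃ k : ℤ, -S.err j ≤ (S.s j : ℝ) * (n * α + ρ - k) ∧ (S.s j : ℝ) * (n * α + ρ - k) ≤ 0 := by
  obtain ⟨a1, a2⟩ := beatty_bounds α ρ n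
  obtain ⟨b1, b2⟩ := beatty_bounds α ρ (n + S.q j)
  have e : (S.s j : ℝ) * (S.q j * α - S.p j) = S.err j := rfl
  unfold chi defect at h
  rw [← e]
  rcases S.s_unit j with hs | hs <;> rw [hs] at h ⊢
  · have h' : beatty α ρ (n + S.q j) = beatty α ρ n + S.p j + 1 := by omega
    rw [h'] at b1 b2
    push_cast at b1 b2
    refine ⟨beatty α ρ n + 1, ?_, ?_⟩ <;> push_cast <;> linarith
  · have h' : beatty α ρ (n + S.q j) = beatty α ρ n + S.p j - 1 := by omega
    rw [h'] at b1 b2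
    push_cast at b1 b2
    refine ⟨beatty α ρ n, ?_, ?_⟩ <;> push_cast <;> linarith

lemma hit_of_mem {j n : ℕ} {k : ℤ} (h1 : -S.err j < (S.s j : ℝ) * (n * α + ρ - k))
    (h2 : (S.s j : ℝ) * (n * α + ρ - k) < 0) : S.chi ρ j n = 1 := by
  have e : (S.s j : ℝ) * (S.q j * α - S.p j) = S.err j := rfl
  have h3 := S.err_lt_one j
  unfold chi defect beatty
  rw [← e] at h1 h3
  rcases S.s_unit j with hs | hs <;> rw [hs] at h1 h2 h3 ⊢ <;> push_cast at h1 h2 h3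
  · have f1 : ⌊(n : ℝ) * α + ρ⌋ = k - 1 := by
      rw [Int.floor_eq_iff]; push_cast; constructor <;> linarith
    have f2 : ⌊((n + S.q j : ℕ) : ℝ) * α + ρ⌋ = k + S.p j := by
      rw [Int.floor_eq_iff]; push_cast; constructor <;> linarith
    rw [f1, f2]; ring
  · have f1 : ⌊(n : ℝ) * α + ρ⌋ = k := by
      rw [Int.floor_eq_iff]; constructor <;> linarith
    have f2 : ⌊((n + S.q j : ℕ) : ℝ) * α + ρ⌋ = k + S.p j - 1 := by
      rw [Int.floor_eq_iff]; push_cast; constructor <;> linarith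
    rw [f1, f2]; ring

/-! ### The growth rate of the denominators and upper bounds -/

/-- `K` is the upper limit of the ratios `q (j + 1) / q j`. -/
def HasGrowth (K : ℝ) : Prop :=
  (∀ ε > 0, ∀ᶠ j in Filter.atTop, (S.q (j + 1) : ℝ) ≤ (K + ε) * S.q j) ∧
    ∀ ε > 0, ∃ᶠ j in Filter.atTop, (K - ε) * S.q j ≤ (S.q (j + 1) : ℝ)

lemma exists_hasGrowth {M : ℕ} (hM : ∀ j, S.a j ≤ M) : ∃ K, S.HasGrowth K := by
  have hb : ∀ j, (S.q (j + 1) : ℝ) / S.q j ≤ max ((M : ℝ) + 1) (S.q 1) := by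
    intro j
    have hq : (0 : ℝ) < S.q j := by exact_mod_cast S.q_pos j
    cases j with
    | zero => rw [S.q_zero]; simp
    | succ j =>
      refine le_max_of_le_left ?_
      rw [div_le_iff₀ hq]
      have h1 : S.q (j + 1 + 1) ≤ (M + 1) * S.q (j + 1) := by
        have h2 := S.q_rec j
        have h3 := Nat.mul_le_mul_right (S.q (j + 1)) (hM j)
        have h4 := S.q_le_succ j
        have e : S.q (j + 1 + 1) = S.q (j + 2) := rfl
        rw [e, h2, add_mul]
        omega
      exact_mod_cast h1
  have hbdd : Filter.IsBoundedUnder (· ≤ ·) Filter.atTop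
      (fun j => (S.q (j + 1) : ℝ) / S.q j) := Filter.isBoundedUnder_of ⟨_, hb⟩
  have hcob : Filter.IsCoboundedUnder (· ≤ ·) Filter.atTop
      (fun j => (S.q (j + 1) : ℝ) / S.q j) := by
    refine Filter.IsBoundedUnder.isCoboundedUnder_le (Filter.isBoundedUnder_of ⟨0, fun j => ?_⟩)
    change (0 : ℝ) ≤ (S.q (j + 1) : ℝ) / S.q j
    positivity
  refine ⟨Filter.limsup (fun j => (S.q (j + 1) : ℝ) / S.q j) Filter.atTop, fun ε hε => ?_,
    fun ε hε => ?_⟩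
  · filter_upwards [Filter.eventually_lt_of_limsup_lt (lt_add_of_pos_right _ hε) hbdd] with j hj
    have hq : (0 : ℝ) < S.q j := by exact_mod_cast S.q_pos j
    exact ((div_lt_iff₀ hq).1 hj).le
  · refine (Filter.frequently_lt_of_lt_limsup hcob (sub_lt_self _ hε)).mono fun j hj => ?_
    have hq : (0 : ℝ) < S.q j := by exact_mod_cast S.q_pos j
    exact ((lt_div_iff₀ hq).1 hj).le

variable {S}

lemma HasGrowth.one_le {K : ℝ} (hK : S.HasGrowth K) : 1 ≤ K := by
  refine le_of_forall_pos_le_add fun ε hε => ?_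
  obtain ⟨j, hj⟩ := (hK.1 ε hε).exists
  have hq : (0 : ℝ) < S.q j := by exact_mod_cast S.q_pos j
  have h1 : (S.q j : ℝ) ≤ S.q (j + 1) := by exact_mod_cast S.q_le_succ j
  by_contra! hc
  nlinarith

lemma HasGrowth.exists_le {K : ℝ} (hK : S.HasGrowth K) {ε : ℝ} (hε : 0 < ε) :
    ∃ M : ℝ, 0 ≤ M ∧ ∀ j, (S.q (j + 1) : ℝ) ≤ (K + ε) * S.q j + M := by
  obtain ⟨N, hN⟩ := Filter.eventually_atTop.1 (hK.1 ε hε)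
  refine ⟨S.q (N + 1), Nat.cast_nonneg _, fun j => ?_⟩
  have hK1 := hK.one_le
  rcases le_total N j with h | h
  · have := hN j h
    have h2 : (0 : ℝ) ≤ S.q (N + 1) := Nat.cast_nonneg _
    linarith
  · have h1 : (S.q (j + 1) : ℝ) ≤ S.q (N + 1) := by exact_mod_cast S.q_mono (by omega)
    have h2 : (0 : ℝ) ≤ (K + ε) * S.q j := by positivity
    linarith

variable (S)

lemma exists_level (T : ℕ) (hT : 1 ≤ T) : ∃ j, S.q j ≤ T ∧ T + 1 ≤ S.q (j + 1) := by
  classical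
  have h : ∃ j, T < S.q j := ⟨T + 1, S.le_q (T + 1)⟩
  have h1 := Nat.find_spec h
  have h2 : Nat.find h ≠ 0 := by
    intro hc
    rw [hc, S.q_zero] at h1
    omega
  obtain ⟨j, hj⟩ := Nat.exists_eq_succ_of_ne_zero h2
  refine ⟨j, ?_, ?_⟩
  · have := Nat.find_min h (m := j) (by omega)
    omega
  · rw [hj] at h1; exact h1

/-- Consecutive levels provide approximations on opposite sides of `G`. If level `j` approximates
within `b ^ (-T)` for all `T < q (j + 1)`, with denominators `b ^ L` for `L ≤ q j + c T + 1`, then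
the irrationality exponent is at most `1 + c + K`. -/
lemma irrationalityExponent_le_of_levels {b : ℕ} (hb : 2 ≤ b) {K : ℝ} (hK : S.HasGrowth K)
    {G c : ℝ} (hc : 0 ≤ c) (h : ∀ j T : ℕ, T + 1 ≤ S.q (j + 1) →
      ∃ L : ℕ, (L : ℝ) ≤ S.q j + c * T + 1 ∧ HasSideApprox b G (S.s j) L T) :
    irrationalityExponent G ≤ ((1 + c + K : ℝ) : EReal) := by
  by_contra! hlt
  obtain ⟨x, h1, h2⟩ := EReal.lt_iff_exists_real_btwn.1 hlt
  have h1' : 1 + c + K < x := by exact_mod_cast h1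
  set ε := x - (1 + c + K) with hε
  have hε0 : 0 < ε := by linarith
  have hK1 := hK.one_le
  obtain ⟨M, hM0, hM⟩ := hK.exists_le hε0
  refine absurd h2 (not_lt.2 ?_)
  have hx : x = 1 + (c + K + ε) := by rw [hε]; ring
  rw [hx]
  refine irrationalityExponent_le_of_sideApprox hb (by linarith)
    (C := 2 * (c + K + ε) + M + 1) fun s hs T => ?_
  obtain ⟨j, hj1, hj2⟩ := S.exists_level (T + 2) (by omega)
  have hj1' : (S.q j : ℝ) ≤ T + 2 := by exact_mod_cast hj1
  have hT : (0 : ℝ) ≤ T := Nat.cast_nonneg _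
  have key : s = S.s j ∨ s = S.s (j + 1) := by
    rw [S.s_succ]
    rcases hs with rfl | rfl <;> rcases S.s_unit j with h | h <;> rw [h] <;> simp
  rcases key with rfl | rfl
  · obtain ⟨L, hL, hA⟩ := h j (T + 2) hj2
    refine ⟨L, T + 2, le_rfl, ?_, hA⟩
    push_cast at hL
    nlinarith
  · obtain ⟨L, hL, hA⟩ := h (j + 1) (T + 2) (hj2.trans (S.q_le_succ _))
    refine ⟨L, T + 2, le_rfl, ?_, hA⟩
    push_cast at hL
    have := hM j
    nlinarith

theorem irrationalityExponent_le {b : ℕ} (hb : 2 ≤ b) {K : ℝ} (hK : S.HasGrowth K) (ρ : ℝ) :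
    irrationalityExponent (beattySum b α ρ) ≤ ((1 + 1 + K : ℝ) : EReal) := by
  refine S.irrationalityExponent_le_of_levels hb hK zero_le_one fun j T hT => ?_
  obtain ⟨t, ht, htmin⟩ := S.exists_first_hit ρ j
  rcases le_or_gt T t with h | h
  · refine ⟨0 + S.q j, ?_, S.hasSideApprox hb fun n _ hn => ?_⟩
    · push_cast
      have : (0 : ℝ) ≤ T := Nat.cast_nonneg _
      linarith
    · have := htmin n hn
      omega
  · refine ⟨(t + 1) + S.q j, ?_, S.hasSideApprox hb fun n hn' hn => ?_⟩
    · push_cast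
      have : (t : ℝ) ≤ T := by exact_mod_cast h.le
      linarith
    · have := S.gap ht hn hn'
      omega

/-! ### The characteristic word -/

lemma q_le_of_hit_zero {j n : ℕ} (hn : 1 ≤ n) (h : S.chi 0 j n = 1) : S.q (j + 1) ≤ n := by
  by_contra! hc
  obtain ⟨k, hk1, hk2⟩ := S.exists_of_hit h
  have h1 := S.best_approximation j (m := n) (k := k) (by omega) (by omega)
  have e1 := S.err_pos j
  have e2 := S.err_pos (j + 1)
  push_cast at h1
  rw [add_zero] at hk1 hk2
  rcases h1 with h1 | h1 <;> linarith

theorem irrationalityExponent_beattySum_zero {b : ℕ} (hb : 2 ≤ b) {K : ℝ} (hK : S.HasGrowth K) :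
    irrationalityExponent (beattySum b α 0) = ((1 + K : ℝ) : EReal) := by
  have hK1 := hK.one_le
  refine le_antisymm ?_ (le_irrationalityExponent (by linarith) fun ν hν hνK => ?_)
  · have := S.irrationalityExponent_le_of_levels hb hK (G := beattySum b α 0) le_rfl
      fun j T hT => ⟨1 + S.q j, by push_cast; linarith, S.hasSideApprox hb fun n hn' hn => by
        have := S.q_le_of_hit_zero hn' hn
        omega⟩
    rwa [add_zero] at this
  · refine approxSet_infinite hb hν fun N => ?_
    set ε := (1 + K - ν) / 2 with hε
    have hε0 : 0 < ε := by linarith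
    obtain ⟨N', hN'⟩ := exists_nat_gt ((2 * ν + 2) / ε)
    obtain ⟨j, hj, hjK⟩ := (Filter.frequently_atTop.1 (hK.2 ε hε0)) (max N N')
    have hq1 := S.q_pos (j + 1)
    have hjq := S.le_q j
    have hW : 1 + S.q j + (S.q (j + 1) - 1) = S.q j + S.q (j + 1) := by omega
    refine ⟨S.s j, 1 + S.q j, S.q (j + 1) - 1, S.s_unit j, ?_, ?_, S.hasSideApprox hb ?_⟩
    · have := le_max_left N N'
      omega
    · rw [hW]
      push_cast
      have h1 : (N' : ℝ) ≤ S.q j := by exact_mod_cast ((le_max_right N N').trans hj).trans hjq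
      have h2 : 2 * ν + 2 < S.q j * ε := by
        refine ((div_lt_iff₀ hε0).1 hN').trans_le ?_
        gcongr
      have h3 : ν = 1 + K - 2 * ε := by rw [hε]; ring
      rw [h3] at h2 ⊢
      nlinarith
    · intro n hn' hn
      have := S.q_le_of_hit_zero hn' hn
      omega

/-! ### An extremal intercept -/

/-- For a generic intercept `ρ`, there are infinitely many levels `j` with `q (j + 1) / q j` close
to its upper limit such that a hit of level `j` with a long return time occurs at a time `n` that is
small compared with `q j`. -/
lemma exists_extremal_intercept {K : ℝ} (hK : S.HasGrowth K) :
    ∃ ρ : ℝ, 0 ≤ ρ ∧ ρ < 1 ∧ ∀ m : ℕ, ∃ j n : ℕ, m ≤ j ∧ (m + 1) * n ≤ S.q j ∧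
      (K - 1 / ((m : ℝ) + 1)) * S.q j ≤ (S.q (j + 1) : ℝ) ∧
      S.chi ρ (j + 1) (n + S.q j) = 1 := by
  set U : ℕ → Set ℝ := fun m => ⋃ j : ℕ, ⋃ n : ℕ, ⋃ _ : m ≤ j ∧ (m + 1) * n ≤ S.q j ∧
      (K - 1 / ((m : ℝ) + 1)) * S.q j ≤ (S.q (j + 1) : ℝ),
      interior {ρ | S.chi ρ (j + 1) (n + S.q j) = 1} with hU
  have hopen : ∀ m, IsOpen (U m) := fun m =>
    isOpen_iUnion fun j => isOpen_iUnion fun n => isOpen_iUnion fun _ => isOpen_interior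
  have hdense : ∀ m, Dense (U m) := by
    intro m
    rw [Metric.dense_iff]
    intro x r hr
    -- Since all levels have hits, some `k - n α` is close to `x`.
    obtain ⟨N, hN⟩ := exists_nat_gt (4 / r)
    have herr : ∀ j, N ≤ j → S.err j < r / 4 := by
      intro j hj
      have h1 := S.err_mul_q_lt_one j
      have h2 : (N : ℝ) ≤ S.q (j + 1) := by
        exact_mod_cast hj.trans ((Nat.le_succ j).trans (S.le_q (j + 1)))
      have h3 := S.err_pos j
      have h4 : 4 < N * r := (div_lt_iff₀ hr).1 hN
      by_contra! hc
      nlinarith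
    obtain ⟨n, -, hn⟩ := S.exists_hit x N 0
    obtain ⟨k, hk1, hk2⟩ := S.exists_of_hit hn
    have hk : |n * α + x - k| < r / 4 := by
      have := herr N le_rfl
      rw [abs_lt]
      rcases S.s_unit N with h | h <;> rw [h] at hk1 hk2 <;> push_cast at hk1 hk2 <;>
        constructor <;> linarith
    obtain ⟨j, hj, hjK⟩ := (Filter.frequently_atTop.1
      (hK.2 (1 / ((m : ℝ) + 1)) (by positivity))) (max (max m N) ((m + 1) * n))
    have hjm : m ≤ j := ((le_max_left _ _).trans (le_max_left _ _)).trans hj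
    have hjN : N ≤ j := ((le_max_right _ _).trans (le_max_left _ _)).trans hj
    have hjn : (m + 1) * n ≤ S.q j := ((le_max_right _ _).trans hj).trans (S.le_q j)
    have e0 := herr j hjN
    have e1 := herr (j + 1) (by omega)
    have e2 := S.err_pos j
    have e3 := S.err_pos (j + 1)
    set z : ℝ := k - n * α - S.s j * S.err j + S.s j * (S.err (j + 1) / 2) with hz
    refine ⟨z, ?_, ?_⟩
    · rw [Metric.mem_ball, Real.dist_eq]
      have := abs_lt.1 hk
      rw [abs_lt, hz]
      rcases S.s_unit j with h | h <;> rw [h] <;> push_cast <;> constructor <;> linarith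
    · simp only [hU, Set.mem_iUnion]
      refine ⟨j, n, ⟨hjm, hjn, hjK⟩, ?_⟩
      set f : ℝ → ℝ := fun ρ => (S.s (j + 1) : ℝ) *
        ((n + S.q j : ℕ) * α + ρ - (k + S.p j : ℤ)) with hf
      have hcont : Continuous f := by fun_prop
      refine mem_interior.2 ⟨f ⁻¹' Set.Ioo (-S.err (j + 1)) 0, fun ρ hρ =>
        S.hit_of_mem hρ.1 hρ.2, isOpen_Ioo.preimage hcont, ?_⟩
      have hfz : f z = -(S.err (j + 1) / 2) := by
        simp only [hf, hz]
        have e : S.err j = (S.s j : ℝ) * (S.q j * α - S.p j) := rfl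
        rw [e, S.s_succ]
        rcases S.s_unit j with h | h <;> rw [h] <;> push_cast <;> ring
      rw [Set.mem_preimage, hfz]
      constructor <;> linarith
  -- By Baire's theorem some `ρ` in the unit interval lies in all the sets `U m`.
  have hd := dense_iInter_of_isOpen hopen hdense
  obtain ⟨ρ, hρ1, hρ2⟩ := hd.exists_mem_open isOpen_Ioo (Set.nonempty_Ioo.2 (zero_lt_one (α := ℝ)))
  refine ⟨ρ, hρ2.1.le, hρ2.2, fun m => ?_⟩
  have := Set.mem_iInter.1 hρ1 m
  simp only [hU, Set.mem_iUnion] at this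
  obtain ⟨j, n, ⟨h1, h2, h3⟩, h4⟩ := this
  have h5 : ρ ∈ {ρ | S.chi ρ (j + 1) (n + S.q j) = 1} := interior_subset h4
  exact ⟨j, n, h1, h2, h3, h5⟩

theorem exists_intercept {K : ℝ} (hK : S.HasGrowth K) :
    ∃ ρ : ℝ, 0 ≤ ρ ∧ ρ < 1 ∧ ∀ b : ℕ, 2 ≤ b →
      irrationalityExponent (beattySum b α ρ) = ((1 + 1 + K : ℝ) : EReal) := by
  have hK1 := hK.one_le
  obtain ⟨ρ, h0, h1, h⟩ := S.exists_extremal_intercept hK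
  refine ⟨ρ, h0, h1, fun b hb => le_antisymm (S.irrationalityExponent_le hb hK ρ)
    (le_irrationalityExponent (by linarith) fun ν hν hνK => ?_)⟩
  refine approxSet_infinite hb hν fun N => ?_
  set δ := 1 + 1 + K - ν with hδ
  have hδ0 : 0 < δ := by linarith
  obtain ⟨m, hm⟩ := exists_nat_gt (N + 2 * ((2 * ν + 2) / δ) + 2 * ((ν + 1) / δ))
  have hdiv1 : 0 ≤ (2 * ν + 2) / δ := by positivity
  have hdiv2 : 0 ≤ (ν + 1) / δ := by positivity
  have hN0 : (0 : ℝ) ≤ N := Nat.cast_nonneg _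
  obtain ⟨j, n, hj, hn, hjK, hhit⟩ := h m
  have hq1 := S.q_pos (j + 1)
  have hq0 := S.q_pos j
  have hjq := S.le_q j
  have hmN : N ≤ m := by
    have : (N : ℝ) ≤ m := by linarith
    exact_mod_cast this
  have hW : n + 1 + S.q j + (S.q (j + 1) + S.q j - 1) = n + S.q (j + 1) + 2 * S.q j := by omega
  refine ⟨S.s j, n + 1 + S.q j, S.q (j + 1) + S.q j - 1, S.s_unit j, by omega, ?_,
    S.hasSideApprox hb ?_⟩
  · rw [hW]
    push_cast
    have hm1 : 2 * ν + 2 < m * (δ / 2) := by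
      have : (2 * ν + 2) / δ < m / 2 := by linarith
      rw [div_lt_iff₀ hδ0] at this
      linarith
    have hm2 : ν + 1 < m * (δ / 2) := by
      have : (ν + 1) / δ < m / 2 := by linarith
      rw [div_lt_iff₀ hδ0] at this
      linarith
    have hmq : (m : ℝ) ≤ S.q j := by exact_mod_cast hj.trans hjq
    have hnq : ((m : ℝ) + 1) * n ≤ S.q j := by exact_mod_cast hn
    have hm0 : (0 : ℝ) ≤ m := Nat.cast_nonneg _
    have hn0 : (0 : ℝ) ≤ n := Nat.cast_nonneg _
    have hQ : (0 : ℝ) < S.q j := by exact_mod_cast hq0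
    -- The loss `ν n + q j / (m + 1)` is at most `(δ / 2) q j`.
    have e1 : (n : ℝ) ≤ S.q j / (m + 1) := by
      rw [le_div_iff₀ (by positivity)]; linarith
    have e2 : (ν + 1) * (S.q j / (m + 1)) ≤ δ / 2 * S.q j := by
      rw [← mul_div_assoc, div_le_iff₀ (by positivity)]
      nlinarith
    have e3 : 2 * ν + 2 < δ / 2 * S.q j := by nlinarith
    have e4 : K * S.q j - S.q j / (m + 1) ≤ S.q (j + 1) := by
      calc _ = (K - 1 / ((m : ℝ) + 1)) * S.q j := by ring
        _ ≤ _ := hjK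
    have e5 : ν * n ≤ ν * (S.q j / (m + 1)) := by gcongr
    have e6 : ν * S.q j = (2 + K - δ) * S.q j := by rw [hδ]; ring
    nlinarith
  · intro k hk' hk
    have := S.long_gap hhit hk hk'
    omega

end ConvergentSystem

namespace ConvergentSystem

/-! ### First hits under a bound on the quality of approximation -/

/-- Every approximation of `beattySum b α ρ` used for the lower bound, from level `J` on, has
quality at most `1 + lam`. The clauses concern, in this order, the stretch before the first hit, the
stretch following a hit `t`, and the quasi-period `q (j + 1) + q j`. -/
structure QualityBound {α : ℝ} (S : ConvergentSystem α) (ρ lam : ℝ) (J : ℕ) : Prop where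
  start : ∀ j ≥ J, ∀ W : ℕ, (∀ n, S.chi ρ j n = 1 → W ≤ n) → (W : ℝ) ≤ lam * S.q j
  after : ∀ j ≥ J, ∀ t W : ℕ, (∀ n, t < n → S.chi ρ j n = 1 → t + W ≤ n) →
    (W : ℝ) ≤ lam * (t + S.q j)
  mid : ∀ j ≥ J, ∀ W : ℕ, (∀ n, S.psi ρ j n = 1 → W ≤ n) →
    (W : ℝ) ≤ lam * (S.q (j + 1) + S.q j)

variable {α : ℝ} {S : ConvergentSystem α} {ρ lam : ℝ} {J : ℕ}

lemma exists_qualityBound (S : ConvergentSystem α) {b : ℕ} (hb : 2 ≤ b) {ν : ℝ} (hν : 0 < ν)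
    (hfin : ¬ (approxSet (beattySum b α ρ) ν).Infinite) (hlam0 : 0 ≤ lam) (hlam : ν - 1 < lam) :
    ∃ J, S.QualityBound ρ lam J := by
  have h := mt (approxSet_infinite hb hν) hfin
  push Not at h
  obtain ⟨N, hN⟩ := h
  obtain ⟨N', hN'⟩ := exists_nat_gt ((2 * ν + 2) / (lam - (ν - 1)))
  have hd : 0 < lam - (ν - 1) := by linarith
  rw [div_lt_iff₀ hd] at hN'
  have key : ∀ (s : ℤ) (L W : ℕ), (s = 1 ∨ s = -1) → max N N' ≤ L →
      (HasSideApprox b (beattySum b α ρ) s L W ∨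
        HasSideApprox b (beattySum b α ρ) s (L + 1) (W - 1)) → (W : ℝ) ≤ lam * L := by
    intro s L W hs hL hA
    have h1 : (N' : ℝ) ≤ L := by exact_mod_cast (le_max_right N N').trans hL
    have h2 : N ≤ L := (le_max_left N N').trans hL
    have h3 : (N' : ℝ) * (lam - (ν - 1)) ≤ L * (lam - (ν - 1)) := by gcongr
    rcases hA with hA | hA
    · by_contra! hc
      refine hN s L W hs (by omega) ?_ hA
      push_cast
      nlinarith
    · by_contra! hc
      have hW : 1 ≤ W := by
        by_contra! hW
        obtain rfl : W = 0 := by omega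
        have : (0 : ℝ) ≤ lam * L := by positivity
        push_cast at hc
        linarith
      refine hN s (L + 1) (W - 1) hs (by omega) ?_ hA
      rw [show L + 1 + (W - 1) = L + W by omega]
      push_cast
      nlinarith
  refine ⟨max N N', fun j hj W hW => ?_, fun j hj t W hW => ?_, fun j hj W hW => ?_⟩
  · have := key (S.s j) (0 + S.q j) W (S.s_unit j)
      (by rw [zero_add]; exact hj.le.trans (S.le_q j))
      (Or.inl (S.hasSideApprox hb fun n _ hn => by rw [zero_add]; exact hW n hn))
    rwa [zero_add] at this
  · have hq := S.le_q j
    have := key (S.s j) (t + S.q j) W (S.s_unit j) (by omega) (Or.inr (by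
      rw [show t + S.q j + 1 = (t + 1) + S.q j by ring]
      refine S.hasSideApprox hb fun n hn hn' => ?_
      have := hW n hn hn'
      omega))
    push_cast at this
    exact this
  · have hq := S.le_q j
    have := key (S.s j) (0 + (S.q (j + 1) + S.q j)) W (S.s_unit j) (by omega)
      (Or.inl (S.hasSideApprox_psi hb fun n _ hn => by rw [zero_add]; exact hW n hn))
    rw [zero_add] at this
    push_cast at this
    exact this

/-- The rational number `151 / 100` slightly exceeds `2 / 3 + 4 √10 / 15`; it replaces `lam` wherever
there is room to spare, which makes the inequalities linear. -/
lemma QualityBound.first_hit_le (hQ : S.QualityBound ρ lam J) (hlam : lam ≤ 151 / 100) {j t : ℕ}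
    (hj : J ≤ j) (htmin : ∀ n, S.chi ρ j n = 1 → t ≤ n) : (t : ℝ) ≤ 151 / 100 * S.q j := by
  refine (hQ.start j hj t htmin).trans ?_
  gcongr

lemma QualityBound.q_succ_le (hQ : S.QualityBound ρ lam J) (hlam : lam ≤ 151 / 100) {j t : ℕ}
    (hj : J ≤ j) (ht : S.chi ρ j t = 1) : (S.q (j + 1) : ℝ) ≤ 151 / 100 * (t + S.q j) := by
  refine (hQ.after j hj t (S.q (j + 1)) fun n hn hn' => S.gap ht hn' hn).trans ?_
  gcongr

section FirstHits

variable {t : ℕ → ℕ} (ht : ∀ j, S.chi ρ j (t j) = 1) (htmin : ∀ j n, S.chi ρ j n = 1 → t j ≤ n)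
include ht htmin

/-- The first hit of the next level either precedes that of the present one by `q (j + 1)`, or
follows it by `q j`; later positions would yield too good an approximation. -/
lemma QualityBound.first_hit_cases (hQ : S.QualityBound ρ lam J) (hlam : lam ≤ 151 / 100) {j : ℕ}
    (hj : J ≤ j) : t j = t (j + 1) + S.q (j + 1) ∨ t (j + 1) = t j + S.q j := by
  have hq1 := S.q_pos (j + 1)
  have hq2 := S.q_add_le j
  have e : S.q (j + 1 + 1) = S.q (j + 2) := rfl
  rcases Nat.lt_or_ge (t (j + 1)) (t j) with h | h
  · left
    have h1 := S.hit_add_of_hit_succ (ht (j + 1))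
    have h2 := htmin j _ h1
    rcases h2.eq_or_lt with h3 | h3
    · exact h3
    · have := S.gap (ht j) h1 h3
      omega
  · right
    rcases S.hit_succ_or_hit (ht j) with h1 | ⟨h1, h2⟩
    · have h2 := htmin (j + 1) _ h1
      rcases h2.eq_or_lt with h3 | h3
      · exact h3
      · have := S.gap (ht (j + 1)) h1 h3
        omega
    · have hne : t j ≠ t (j + 1) := by
        intro hc
        have := ht (j + 1)
        rw [← hc] at this
        omega
      rcases Nat.lt_or_ge (t (j + 1)) (S.q j) with h3 | h3
      · have := S.gap h2 (S.hit_add_of_hit_succ (ht (j + 1))) (by omega)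
        have := S.q_le_succ j
        omega
      · obtain ⟨n, hn⟩ : ∃ n, t (j + 1) = n + S.q j := ⟨t (j + 1) - S.q j, by omega⟩
        have h4 : S.chi ρ j n = 1 := S.hit_of_hit_succ (by rw [← hn]; exact ht (j + 1))
        rcases (htmin j n h4).eq_or_lt with h5 | h5
        · rw [hn, h5]
        · exfalso
          have h6 := S.gap (ht j) h4 h5
          have h7 := hQ.first_hit_le hlam (hj.trans (Nat.le_succ j)) (htmin (j + 1))
          have h8 := hQ.q_succ_le hlam hj (ht j)
          have h9 : (t j + S.q (j + 1) + S.q j : ℝ) ≤ t (j + 1) := by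
            exact_mod_cast (by omega : t j + S.q (j + 1) + S.q j ≤ t (j + 1))
          have h10 : (1 : ℝ) ≤ S.q (j + 1) := by exact_mod_cast hq1
          linarith

/-- In the other case `t j = t (j + 1) + q (j + 1)` of `first_hit_cases`, either the same case occurs
at level `j + 1` and `t j` is too large, or `t (j + 1)` has a long return time, which is too long for
`lam`. -/
lemma QualityBound.first_hit_succ (hQ : S.QualityBound ρ lam J) (hlam : lam ≤ 151 / 100) {j : ℕ}
    (hj : J ≤ j) : t (j + 1) = t j + S.q j := by
  refine (hQ.first_hit_cases ht htmin hlam hj).resolve_left fun h => ?_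
  have h1 : (t j : ℝ) = t (j + 1) + S.q (j + 1) := by exact_mod_cast h
  have h2 := hQ.first_hit_le hlam hj (htmin j)
  have h3 : (S.q (j + 1) + S.q j : ℝ) ≤ S.q (j + 2) := by exact_mod_cast S.q_add_le j
  have h4 : (S.q j : ℝ) ≤ S.q (j + 1) := by exact_mod_cast S.q_le_succ j
  have h5 : (1 : ℝ) ≤ S.q j := by exact_mod_cast S.q_pos j
  have h6 : (0 : ℝ) ≤ t (j + 2) := Nat.cast_nonneg _
  rcases hQ.first_hit_cases ht htmin hlam (hj.trans (Nat.le_succ j)) with h7 | h7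
  · have h8 : (t (j + 1) : ℝ) = t (j + 2) + S.q (j + 2) := by exact_mod_cast h7
    linarith
  · have h8 := hQ.after (j + 1) (hj.trans (Nat.le_succ j)) (t (j + 1)) (S.q (j + 2) + S.q (j + 1))
      fun n hn hn' => by
        have := S.long_gap (n := t (j + 1)) (by rw [← h7]; exact ht (j + 1 + 1)) hn' hn
        rwa [← add_assoc]
    have h9 : lam * (t (j + 1) + S.q (j + 1)) ≤ 151 / 100 * (t (j + 1) + S.q (j + 1) : ℝ) := by
      gcongr
    push_cast at h8
    linarith

/-- The hit `t j` has a long return time, because `t j + q j` is a hit of level `j + 1`. -/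
lemma QualityBound.q_add_q_le (hQ : S.QualityBound ρ lam J) (hlam : lam ≤ 151 / 100) {j : ℕ}
    (hj : J ≤ j) : (S.q (j + 1) + S.q j : ℝ) ≤ lam * t (j + 1) := by
  have h := hQ.first_hit_succ ht htmin hlam hj
  have h1 := hQ.after j hj (t j) (S.q (j + 1) + S.q j) fun n hn hn' => by
    have := S.long_gap (n := t j) (by rw [← h]; exact ht (j + 1)) hn' hn
    rwa [← add_assoc]
  rw [h]
  push_cast at h1 ⊢
  exact h1

/-- The quasi-period `q (j + 1) + q j` has no defect before `t (j + 1) + q (j + 1)`: its defects are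
hits of level `j`, and at `t j` the two terms of `psi` cancel. -/
lemma QualityBound.t_add_q_le (hQ : S.QualityBound ρ lam J) (hlam : lam ≤ 151 / 100) {j : ℕ}
    (hj : J ≤ j) : (t (j + 1) + S.q (j + 1) : ℝ) ≤ lam * (S.q (j + 1) + S.q j) := by
  have h := hQ.first_hit_succ ht htmin hlam hj
  have hhit : S.chi ρ (j + 1) (t j + S.q j) = 1 := by rw [← h]; exact ht (j + 1)
  have h1 := hQ.mid j hj (t (j + 1) + S.q (j + 1)) fun n hn => by
    have h2 := S.psi_eq_chi_sub_add ρ j n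
    have h3 : S.chi ρ j n = 1 ∧ S.chi ρ (j + 1) (n + S.q j) = 0 := by
      rcases S.chi_eq ρ j n with h3 | h3 <;>
        rcases S.chi_eq ρ (j + 1) (n + S.q j) with h4 | h4 <;> omega
    have h4 : t j ≠ n := by
      rintro rfl
      omega
    have h5 := S.long_gap hhit h3.1 (lt_of_le_of_ne (htmin j n h3.1) h4)
    omega
  push_cast at h1
  exact h1

end FirstHits

/-! ### The partial quotients of an extremal slope -/

/-- The inequalities relating the denominators `q` and the first hits `t` in case all
approximations have quality at most `1 + lam`. -/
structure Admissible (q t a : ℕ → ℕ) (lam : ℝ) : Prop where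
  q_pos : ∀ j, 1 ≤ q j
  q_le : ∀ j, q j ≤ q (j + 1)
  le_q : ∀ j, j ≤ q j
  a_pos : ∀ j, 1 ≤ a j
  q_rec : ∀ j, q (j + 2) = a j * q (j + 1) + q j
  t_rec : ∀ j, t (j + 1) = t j + q j
  t_le : ∀ j, (t j : ℝ) ≤ 151 / 100 * q j
  q_add_le : ∀ j, (q (j + 1) + q j : ℝ) ≤ lam * t (j + 1)
  t_add_le : ∀ j, (t (j + 1) + q (j + 1) : ℝ) ≤ lam * (q (j + 1) + q j)

namespace Admissible

variable {q t a : ℕ → ℕ} (H : Admissible q t a lam) (hlam : lam ≤ 151 / 100)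
include H

lemma q_rec' (j : ℕ) : (q (j + 2) : ℝ) = a j * q (j + 1) + q j := by
  exact_mod_cast H.q_rec j

lemma t_rec' (j : ℕ) : (t (j + 1) : ℝ) = t j + q j := by
  exact_mod_cast H.t_rec j

lemma q_pos' (j : ℕ) : (1 : ℝ) ≤ q j := by exact_mod_cast H.q_pos j

lemma q_le' (j : ℕ) : (q j : ℝ) ≤ q (j + 1) := by exact_mod_cast H.q_le j

include hlam

lemma q_add_le' (j : ℕ) : (q (j + 1) + q j : ℝ) ≤ 151 / 100 * t (j + 1) :=
  (H.q_add_le j).trans (by gcongr)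

lemma t_add_le' (j : ℕ) : (t (j + 1) + q (j + 1) : ℝ) ≤ 151 / 100 * (q (j + 1) + q j) :=
  (H.t_add_le j).trans (by gcongr)

lemma a_eq (j : ℕ) : a j = 1 ∨ a j = 2 := by
  have h0 := H.a_pos j
  by_contra! hc
  have h1 : (3 : ℝ) ≤ a j := by exact_mod_cast (by omega : 3 ≤ a j)
  have h2 := H.q_rec' j
  have h3 := H.q_add_le' hlam (j + 1)
  have h4 := H.t_add_le' hlam j
  have h5 := H.t_rec' (j + 1)
  have h6 := H.q_le' j
  have h7 := H.q_pos' (j + 1)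
  have h8 : 3 * (q (j + 1) : ℝ) ≤ a j * q (j + 1) := by gcongr
  linarith

lemma q_le_of_a_eq_two {j : ℕ} (h : a j = 2) : 7199 * (q (j + 1) : ℝ) ≤ 12801 * q j := by
  have h2 := H.q_rec' j
  rw [h] at h2
  push_cast at h2
  have h3 := H.q_add_le' hlam (j + 1)
  have h4 := H.t_add_le' hlam j
  have h5 := H.t_rec' (j + 1)
  linarith

lemma not_two_two {j : ℕ} (h : a j = 2) : a (j + 1) = 1 := by
  refine (H.a_eq hlam (j + 1)).resolve_right fun h1 => ?_
  have h2 := H.q_rec' j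
  rw [h] at h2
  push_cast at h2
  have h3 := H.q_le_of_a_eq_two hlam h1
  have h4 := H.q_pos' (j + 1)
  have h5 := H.q_pos' j
  have e : q (j + 1 + 1) = q (j + 2) := rfl
  rw [e] at h3
  linarith

lemma not_two_one_two {j : ℕ} (h : a j = 2) : a (j + 2) = 1 := by
  have h1 := H.not_two_two hlam h
  refine (H.a_eq hlam (j + 2)).resolve_right fun h2 => ?_
  have e0 := H.q_rec' j
  have e1 : (q (j + 3) : ℝ) = a (j + 1) * q (j + 2) + q (j + 1) := H.q_rec' (j + 1)
  have e2 : (q (j + 4) : ℝ) = a (j + 2) * q (j + 3) + q (j + 2) := H.q_rec' (j + 2)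
  rw [h] at e0
  rw [h1] at e1
  rw [h2] at e2
  push_cast at e0 e1 e2
  have f1 : (t (j + 2) : ℝ) = t (j + 1) + q (j + 1) := H.t_rec' (j + 1)
  have f2 : (t (j + 3) : ℝ) = t (j + 2) + q (j + 2) := H.t_rec' (j + 2)
  have f3 : (t (j + 4) : ℝ) = t (j + 3) + q (j + 3) := H.t_rec' (j + 3)
  have g1 : (q (j + 4) + q (j + 3) : ℝ) ≤ 151 / 100 * t (j + 4) := H.q_add_le' hlam (j + 3)
  have g2 := H.t_le (j + 1)
  have g3 := H.q_le_of_a_eq_two hlam h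
  have g4 := H.q_pos' j
  linarith

lemma not_one_one_one {j : ℕ} (h : a j = 1) (h1 : a (j + 1) = 1) : a (j + 2) = 2 := by
  refine (H.a_eq hlam (j + 2)).resolve_left fun h2 => ?_
  have e0 := H.q_rec' j
  have e1 : (q (j + 3) : ℝ) = a (j + 1) * q (j + 2) + q (j + 1) := H.q_rec' (j + 1)
  have e2 : (q (j + 4) : ℝ) = a (j + 2) * q (j + 3) + q (j + 2) := H.q_rec' (j + 2)
  rw [h] at e0
  rw [h1] at e1
  rw [h2] at e2
  push_cast at e0 e1 e2
  have f1 : (t (j + 2) : ℝ) = t (j + 1) + q (j + 1) := H.t_rec' (j + 1)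
  have f2 : (t (j + 3) : ℝ) = t (j + 2) + q (j + 2) := H.t_rec' (j + 2)
  have f3 : (t (j + 4) : ℝ) = t (j + 3) + q (j + 3) := H.t_rec' (j + 3)
  have g1 : (t (j + 4) + q (j + 4) : ℝ) ≤ 151 / 100 * (q (j + 4) + q (j + 3)) :=
    H.t_add_le' hlam (j + 3)
  have g2 := H.q_add_le' hlam j
  have g4 := H.q_pos' j
  have g5 := H.q_pos' (j + 1)
  linarith

lemma exists_a_eq_two : ∃ j, a j = 2 := by
  rcases H.a_eq hlam 0 with h0 | h0
  · rcases H.a_eq hlam 1 with h1 | h1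
    · exact ⟨2, H.not_one_one_one hlam h0 h1⟩
    · exact ⟨1, h1⟩
  · exact ⟨0, h0⟩

/-- The partial quotients are eventually periodic with period `2, 1, 1`. Along a period the
quantity `t - (2 / 3) (q j + q (j - 1))` is constant, and `q (j - 1) / q j` converges to
`(√10 - 2) / 3`, which turns the bound `t_add_le` into a lower bound for `lam`. -/
lemma le_lam : 2 / 3 + 4 * √10 / 15 ≤ lam := by
  by_contra! hlt
  obtain ⟨j₀, hj₀⟩ := H.exists_a_eq_two hlam
  have ha : ∀ k, a (j₀ + 3 * k) = 2 := by
    intro k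
    induction k with
    | zero => exact hj₀
    | succ k ih =>
      exact H.not_one_one_one hlam (H.not_two_two hlam ih) (H.not_two_one_two hlam ih)
  set Q : ℕ → ℝ := fun k => q (j₀ + 3 * k + 2) with hQ
  set P : ℕ → ℝ := fun k => q (j₀ + 3 * k + 1) with hP
  set T : ℕ → ℝ := fun k => t (j₀ + 3 * k + 2) with hT
  have hstep : ∀ k, Q (k + 1) = 5 * Q k + 3 * P k ∧ P (k + 1) = 2 * Q k + P k ∧
      T (k + 1) = T k + 4 * Q k + 2 * P k ∧
      T k + 4 * Q k + 2 * P k ≤ lam * (3 * Q k + 2 * P k) := by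
    intro k
    set i := j₀ + 3 * k with hi
    have h2 : a i = 2 := ha k
    have h3 := H.not_two_two hlam h2
    have h4 := H.not_two_one_two hlam h2
    have h5 : a (i + 3) = 2 := ha (k + 1)
    have e1 : (q (i + 3) : ℝ) = a (i + 1) * q (i + 2) + q (i + 1) := H.q_rec' (i + 1)
    have e2 : (q (i + 4) : ℝ) = a (i + 2) * q (i + 3) + q (i + 2) := H.q_rec' (i + 2)
    have e3 : (q (i + 5) : ℝ) = a (i + 3) * q (i + 4) + q (i + 3) := H.q_rec' (i + 3)
    rw [h3] at e1
    rw [h4] at e2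
    rw [h5] at e3
    push_cast at e1 e2 e3
    have f2 : (t (i + 3) : ℝ) = t (i + 2) + q (i + 2) := H.t_rec' (i + 2)
    have f3 : (t (i + 4) : ℝ) = t (i + 3) + q (i + 3) := H.t_rec' (i + 3)
    have f4 : (t (i + 5) : ℝ) = t (i + 4) + q (i + 4) := H.t_rec' (i + 4)
    have g : (t (i + 4) + q (i + 4) : ℝ) ≤ lam * (q (i + 4) + q (i + 3)) := H.t_add_le (i + 3)
    change (q (i + 5) : ℝ) = 5 * q (i + 2) + 3 * q (i + 1) ∧
      (q (i + 4) : ℝ) = 2 * q (i + 2) + q (i + 1) ∧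
      (t (i + 5) : ℝ) = t (i + 2) + 4 * q (i + 2) + 2 * q (i + 1) ∧
      (t (i + 2) + 4 * q (i + 2) + 2 * q (i + 1) : ℝ) ≤ lam * (3 * q (i + 2) + 2 * q (i + 1))
    refine ⟨by linarith, by linarith, by linarith, ?_⟩
    have e4 : (q (i + 4) + q (i + 3) : ℝ) = 3 * q (i + 2) + 2 * q (i + 1) := by linarith
    rw [e4] at g
    linarith
  set r := √10 with hr
  have hr2 : r ^ 2 = 10 := Real.sq_sqrt (by norm_num)
  have hr0 : 0 ≤ r := Real.sqrt_nonneg _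
  have hr3 : 3 ≤ r := by
    by_contra! hc
    nlinarith
  have hr4 : r ≤ 4 := by
    by_contra! hc
    nlinarith
  have hconst : ∀ k, T k - 2 / 3 * (Q k + P k) = T 0 - 2 / 3 * (Q 0 + P 0) := by
    intro k
    induction k with
    | zero => rfl
    | succ k ih =>
      obtain ⟨h1, h2, h3, -⟩ := hstep k
      rw [← ih, h1, h2, h3]
      ring
  have hdev : ∀ k, |P k - (r - 2) / 3 * Q k| ≤ |P 0 - (r - 2) / 3 * Q 0| := by
    intro k
    induction k with
    | zero => exact le_rfl
    | succ k ih =>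
      obtain ⟨h1, h2, -, -⟩ := hstep k
      have e : P (k + 1) - (r - 2) / 3 * Q (k + 1) = (3 - r) * (P k - (r - 2) / 3 * Q k) := by
        rw [h1, h2]
        linear_combination (-(Q k) / 3) * hr2
      rw [e, abs_mul]
      have : |3 - r| ≤ 1 := by rw [abs_le]; constructor <;> linarith
      exact (mul_le_of_le_one_left (abs_nonneg _) this).trans ih
  set D := |P 0 - (r - 2) / 3 * Q 0|
  set C := T 0 - 2 / 3 * (Q 0 + P 0)
  have hδ : 0 < 2 / 3 + 4 * r / 15 - lam := by linarith
  obtain ⟨k, hk⟩ := exists_nat_gt ((6 * D + |C|) / (2 / 3 + 4 * r / 15 - lam))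
  rw [div_lt_iff₀ hδ] at hk
  obtain ⟨-, -, -, h4⟩ := hstep k
  have hc := hconst k
  have hd := abs_le.1 (hdev k)
  set d := P k - (r - 2) / 3 * Q k with hdd
  have hPk : P k = (r - 2) / 3 * Q k + d := by rw [hdd]; ring
  have hTk : T k = 2 / 3 * (Q k + P k) + C := by linarith
  have hkQ : (k : ℝ) ≤ Q k := by
    have h5 := H.le_q (j₀ + 3 * k + 2)
    have h6 : (k : ℝ) ≤ (q (j₀ + 3 * k + 2) : ℝ) := by
      exact_mod_cast (by omega : k ≤ q (j₀ + 3 * k + 2))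
    exact h6
  have hlam1 : 0 ≤ lam := by
    have h1 := H.q_add_le 0
    have h2 := H.q_pos' 0
    have h3 := H.q_pos' (0 + 1)
    have h4 : (0 : ℝ) ≤ t (0 + 1) := Nat.cast_nonneg _
    by_contra! hneg
    nlinarith
  rw [hTk, hPk] at h4
  have key : (2 / 3 + 4 * r / 15 - lam) * ((5 + 2 * r) / 3) * Q k ≤ (2 * lam - 8 / 3) * d - C := by
    have e : (2 / 3 + 4 * r / 15) * ((5 + 2 * r) / 3) * Q k = (26 + 8 * r) / 9 * Q k := by
      linear_combination (8 / 45 * Q k) * hr2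
    nlinarith
  have hD0 : 0 ≤ D := abs_nonneg _
  have hbound : (2 * lam - 8 / 3) * d - C ≤ 6 * D + |C| := by
    have h5 : |(2 * lam - 8 / 3) * d| ≤ 6 * D := by
      rw [abs_mul]
      have h6 : |2 * lam - 8 / 3| ≤ 6 := by rw [abs_le]; constructor <;> linarith
      have h7 : |d| ≤ D := abs_le.2 hd
      gcongr
    have := le_abs_self ((2 * lam - 8 / 3) * d)
    have := neg_abs_le C
    linarith
  have hfin : (k : ℝ) * (2 / 3 + 4 * r / 15 - lam) ≤
      (2 / 3 + 4 * r / 15 - lam) * ((5 + 2 * r) / 3) * Q k := by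
    have h5 : (1 : ℝ) ≤ (5 + 2 * r) / 3 := by linarith
    have h6 : (0 : ℝ) ≤ Q k := by positivity
    have h7 : (k : ℝ) ≤ (5 + 2 * r) / 3 * Q k := by nlinarith
    nlinarith
  linarith

end Admissible

theorem QualityBound.le_lam (hQ : S.QualityBound ρ lam J) (hlam : lam ≤ 151 / 100) :
    2 / 3 + 4 * √10 / 15 ≤ lam := by
  choose t ht htmin using S.exists_first_hit ρ
  refine Admissible.le_lam (q := fun j => S.q (J + j)) (t := fun j => t (J + j))
    (a := fun j => S.a (J + j)) ?_ hlam
  have hJ : ∀ j, J ≤ J + j := fun j => Nat.le_add_right _ _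
  exact
    { q_pos := fun j => S.q_pos _
      q_le := fun j => S.q_le_succ _
      le_q := fun j => (Nat.le_add_left _ _).trans (S.le_q _)
      a_pos := fun j => S.a_pos _
      q_rec := fun j => S.q_rec _
      t_rec := fun j => hQ.first_hit_succ ht htmin hlam (hJ j)
      t_le := fun j => hQ.first_hit_le hlam (hJ j) (htmin (J + j))
      q_add_le := fun j => hQ.q_add_q_le ht htmin hlam (hJ j)
      t_add_le := fun j => hQ.t_add_q_le ht htmin hlam (hJ j) }

/-- The lower bound holds for every slope and every intercept. -/
theorem le_irrationalityExponent_beattySum (S : ConvergentSystem α) {b : ℕ} (hb : 2 ≤ b) (ρ : ℝ) :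
    ((5 / 3 + 4 * √10 / 15 : ℝ) : EReal) ≤ irrationalityExponent (beattySum b α ρ) := by
  have hr2 : √10 ^ 2 = 10 := Real.sq_sqrt (by norm_num)
  have hr0 : 0 ≤ √10 := Real.sqrt_nonneg _
  have hr : √10 ≤ 3.1623 := by
    by_contra! hc
    nlinarith
  refine le_irrationalityExponent (by positivity) fun ν hν hlt => ?_
  by_contra hfin
  obtain ⟨lam, h1, h2⟩ := exists_between (show max 0 (ν - 1) < 2 / 3 + 4 * √10 / 15 by
    refine max_lt (by positivity) (by linarith))
  obtain ⟨J, hJ⟩ := S.exists_qualityBound hb hν hfin ((le_max_left _ _).trans h1.le)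
    ((le_max_right _ _).trans_lt h1)
  have := hJ.le_lam (by norm_num at hr ⊢; linarith)
  linarith

end ConvergentSystem

/-! ### The convergents of an irrational number in the unit interval -/

/-- The orbit of `θ` under the Gauss map `x ↦ 1 / x - ⌊1 / x⌋`. -/
noncomputable def gaussOrbit (θ : ℝ) : ℕ → ℝ
  | 0 => θ
  | n + 1 => Int.fract (gaussOrbit θ n)⁻¹

/-- The partial quotient of index `n + 1` of `θ ∈ (0, 1)`. -/
noncomputable def partialQuotient (θ : ℝ) (n : ℕ) : ℕ := ⌊(gaussOrbit θ n)⁻¹⌋₊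

/-- The denominators of the convergents of `θ ∈ (0, 1)`. -/
noncomputable def convDen (θ : ℝ) : ℕ → ℕ
  | 0 => 1
  | 1 => partialQuotient θ 0
  | n + 2 => partialQuotient θ (n + 1) * convDen θ (n + 1) + convDen θ n

/-- The numerators of the convergents of `θ ∈ (0, 1)`. -/
noncomputable def convNum (θ : ℝ) : ℕ → ℤ
  | 0 => 0
  | 1 => 1
  | n + 2 => partialQuotient θ (n + 1) * convNum θ (n + 1) + convNum θ n

section

variable {θ : ℝ} (hirr : Irrational θ) (h0 : 0 < θ) (h1 : θ < 1)
include hirr h0 h1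

lemma gaussOrbit_mem (n : ℕ) :
    Irrational (gaussOrbit θ n) ∧ 0 < gaussOrbit θ n ∧ gaussOrbit θ n < 1 := by
  induction n with
  | zero => exact ⟨hirr, h0, h1⟩
  | succ n ih =>
    have h : Irrational (gaussOrbit θ (n + 1)) := by
      have h2 : Irrational (gaussOrbit θ n)⁻¹ := ih.1.inv
      exact h2.sub_intCast _
    refine ⟨h, lt_of_le_of_ne (Int.fract_nonneg _) fun hc => h.ne_zero hc.symm,
      Int.fract_lt_one _⟩

lemma gaussOrbit_succ (n : ℕ) :
    gaussOrbit θ (n + 1) = (gaussOrbit θ n)⁻¹ - partialQuotient θ n := by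
  have h2 := (gaussOrbit_mem hirr h0 h1 n).2.1
  have h3 : (partialQuotient θ n : ℝ) = ⌊(gaussOrbit θ n)⁻¹⌋ :=
    natCast_floor_eq_intCast_floor (inv_nonneg.2 h2.le)
  rw [h3]
  rfl

lemma one_le_partialQuotient (n : ℕ) : 1 ≤ partialQuotient θ n := by
  obtain ⟨-, h2, h3⟩ := gaussOrbit_mem hirr h0 h1 n
  refine Nat.le_floor ?_
  rw [Nat.cast_one]
  exact (one_le_inv₀ h2).2 h3.le

lemma convDen_mul_sub (n : ℕ) : (convDen θ (n + 1) * θ - convNum θ (n + 1) : ℝ) =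
    -gaussOrbit θ (n + 1) * (convDen θ n * θ - convNum θ n) := by
  induction n with
  | zero =>
    rw [gaussOrbit_succ hirr h0 h1]
    simp only [convDen, convNum, gaussOrbit]
    push_cast
    field_simp
    ring
  | succ n ih =>
    have h2 := (gaussOrbit_mem hirr h0 h1 (n + 1)).2.1
    rw [gaussOrbit_succ hirr h0 h1 (n + 1)]
    have e : (convDen θ n * θ - convNum θ n : ℝ) =
        -((gaussOrbit θ (n + 1))⁻¹ * (convDen θ (n + 1) * θ - convNum θ (n + 1))) := by
      rw [ih]
      field_simp
    simp only [convDen, convNum]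
    push_cast
    linear_combination e

lemma convDen_err_pos (n : ℕ) :
    0 < (((-1 : ℤ) ^ n : ℤ) : ℝ) * (convDen θ n * θ - convNum θ n) := by
  induction n with
  | zero => simpa [convDen, convNum] using h0
  | succ n ih =>
    rw [convDen_mul_sub hirr h0 h1, pow_succ]
    have h2 := mul_pos (gaussOrbit_mem hirr h0 h1 (n + 1)).2.1 ih
    push_cast at h2 ⊢
    linarith

end

/-- The convergents of an irrational number in the unit interval. -/
noncomputable def convergents {θ : ℝ} (hirr : Irrational θ) (h0 : 0 < θ) (h1 : θ < 1) :
    ConvergentSystem θ where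
  q := convDen θ
  p := convNum θ
  a := fun n => partialQuotient θ (n + 1)
  s := fun n => (-1) ^ n
  q_zero := rfl
  q_one_pos := one_le_partialQuotient hirr h0 h1 0
  a_pos := fun j => one_le_partialQuotient hirr h0 h1 _
  q_rec := fun j => rfl
  p_rec := fun j => rfl
  det := Or.inl (by simp [convDen, convNum])
  s_unit := fun j => neg_one_pow_eq_or ℤ j
  s_succ := fun j => by rw [pow_succ]; ring
  err_pos' := convDen_err_pos hirr h0 h1
  err_lt_one' := by simpa [convDen, convNum] using h1

lemma stream_eq_gaussOrbit {θ : ℝ} (hirr : Irrational θ) (h0 : 0 < θ) (h1 : θ < 1) (n : ℕ) :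
    ∃ x, GenContFract.IntFractPair.stream θ n = some x ∧ x.fr = gaussOrbit θ n := by
  induction n with
  | zero =>
    exact ⟨_, GenContFract.IntFractPair.stream_zero θ,
      Int.fract_eq_self.2 ⟨h0.le, h1⟩⟩
  | succ n ih =>
    obtain ⟨x, hx, hfr⟩ := ih
    have hne : x.fr ≠ 0 := by
      rw [hfr]; exact (gaussOrbit_mem hirr h0 h1 n).2.1.ne'
    refine ⟨_, GenContFract.IntFractPair.stream_succ_of_some hx hne, ?_⟩
    rw [hfr]
    rfl

lemma partDens_eq_partialQuotient {θ : ℝ} (hirr : Irrational θ) (h0 : 0 < θ) (h1 : θ < 1)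
    (n : ℕ) : (GenContFract.of θ).partDens.get? n = some (partialQuotient θ n : ℝ) := by
  obtain ⟨x, hx, hfr⟩ := stream_eq_gaussOrbit hirr h0 h1 n
  have h2 := (gaussOrbit_mem hirr h0 h1 n).2.1
  have hne : x.fr ≠ 0 := by rw [hfr]; exact h2.ne'
  have h3 := GenContFract.partDen_eq_s_b
    (GenContFract.get?_of_eq_some_of_succ_get?_intFractPair_stream
      (GenContFract.IntFractPair.stream_succ_of_some hx hne))
  rw [h3, hfr]
  have h4 : (partialQuotient θ n : ℝ) = ⌊(gaussOrbit θ n)⁻¹⌋ :=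
    natCast_floor_eq_intCast_floor (inv_nonneg.2 h2.le)
  rw [h4]
  rfl

lemma exists_partialQuotient_le {θ : ℝ} (hirr : Irrational θ) (h0 : 0 < θ) (h1 : θ < 1)
    (hbdd : HasBoundedPartialQuotients θ) : ∃ M : ℕ, ∀ n, partialQuotient θ n ≤ M := by
  obtain ⟨M, hM⟩ := hbdd
  refine ⟨⌊M⌋₊, fun n => Nat.le_floor ?_⟩
  exact hM n _ (partDens_eq_partialQuotient hirr h0 h1 n)

/-! ### Sturmian numbers as affine images of Beatty sums -/

lemma hasSum_beatty_sub {b : ℕ} (hb : 2 ≤ b) (α ρ : ℝ) :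
    HasSum (fun n => ((beatty α ρ (n + 1) - beatty α ρ n : ℤ) : ℝ) / (b : ℝ) ^ (n + 1))
      ((1 - 1 / b) * beattySum b α ρ - beatty α ρ 0) := by
  have hb0 : (0 : ℝ) < b := by exact_mod_cast (by omega : 0 < b)
  have h : HasSum (fun n => (beatty α ρ n : ℝ) / (b : ℝ) ^ n) (beattySum b α ρ) :=
    (summable_beatty hb α ρ).hasSum
  have h1 : HasSum (fun n => (beatty α ρ (n + 1) : ℝ) / (b : ℝ) ^ (n + 1))
      (beattySum b α ρ - beatty α ρ 0) := by
    have := (hasSum_nat_add_iff' 1).2 h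
    simpa using this
  have h2 := h1.sub (h.mul_left (1 / (b : ℝ)))
  have hv : (1 - 1 / b) * beattySum b α ρ - beatty α ρ 0 =
      beattySum b α ρ - beatty α ρ 0 - 1 / b * beattySum b α ρ := by ring
  rw [hv]
  refine h2.congr_fun fun n => ?_
  push_cast
  rw [pow_succ]
  field_simp

lemma irrationalityExponent_digits {b : ℕ} (hb : 2 ≤ b) (α ρ : ℝ) {d e : ℤ} (he : e ≠ 0) :
    irrationalityExponent (∑' n, (d + e * ((beatty α ρ (n + 1) - beatty α ρ n : ℤ) : ℝ)) /
      (b : ℝ) ^ (n + 1)) = irrationalityExponent (beattySum b α ρ) := by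
  have hb1 : (1 : ℝ) < b := by exact_mod_cast hb
  have hb0 : (0 : ℝ) < b := by linarith
  have hgeo : HasSum (fun n : ℕ => (1 : ℝ) / (b : ℝ) ^ (n + 1)) (1 / (b - 1)) := by
    have h := (hasSum_geometric_of_lt_one (r := (b : ℝ)⁻¹) (by positivity)
      (inv_lt_one_of_one_lt₀ hb1)).mul_left (1 / (b : ℝ))
    have hv : 1 / ((b : ℝ) - 1) = 1 / b * (1 - (b : ℝ)⁻¹)⁻¹ := by
      have : (b : ℝ) - 1 ≠ 0 := by linarith
      field_simp
    rw [hv]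
    refine h.congr_fun fun n => ?_
    rw [pow_succ, inv_pow]
    field_simp
  have h := (hgeo.mul_left (d : ℝ)).add ((hasSum_beatty_sub hb α ρ).mul_left (e : ℝ))
  have hs : ∑' n, (d + e * ((beatty α ρ (n + 1) - beatty α ρ n : ℤ) : ℝ)) / (b : ℝ) ^ (n + 1) =
      (((d : ℚ) / (b - 1) - e * beatty α ρ 0 : ℚ) : ℝ) +
        (((e : ℚ) * (1 - 1 / b) : ℚ) : ℝ) * beattySum b α ρ := by
    have h' : HasSum (fun n => (d + e * ((beatty α ρ (n + 1) - beatty α ρ n : ℤ) : ℝ)) /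
        (b : ℝ) ^ (n + 1)) _ := h.congr_fun fun n => by ring
    rw [h'.tsum_eq]
    push_cast
    ring
  rw [hs]
  refine irrationalityExponent_affine _ _ (mul_ne_zero (by exact_mod_cast he) ?_) _
  have hbq : (1 : ℚ) < b := by exact_mod_cast hb
  have : (1 : ℚ) / b < 1 := (div_lt_one (by linarith)).2 hbq
  linarith

lemma lowerSturmian_eq (θ ρ : ℝ) (n : ℕ) :
    lowerSturmian θ ρ n = beatty θ ρ (n + 1) - beatty θ ρ n := by
  unfold lowerSturmian beatty
  push_cast
  rfl

lemma lowerSturmian_eq_zero_or_one {θ : ℝ} (h0 : 0 < θ) (h1 : θ < 1) (ρ : ℝ) (n : ℕ) :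
    lowerSturmian θ ρ n = 0 ∨ lowerSturmian θ ρ n = 1 := by
  obtain ⟨a1, a2⟩ := beatty_bounds θ ρ n
  obtain ⟨b1, b2⟩ := beatty_bounds θ ρ (n + 1)
  rw [lowerSturmian_eq]
  push_cast at b1 b2
  have c1 : (beatty θ ρ (n + 1) : ℝ) < beatty θ ρ n + 2 := by linarith
  have c2 : (beatty θ ρ n : ℝ) < beatty θ ρ (n + 1) + 1 := by linarith
  have c1' : beatty θ ρ (n + 1) < beatty θ ρ n + 2 := by exact_mod_cast c1
  have c2' : beatty θ ρ n < beatty θ ρ (n + 1) + 1 := by exact_mod_cast c2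
  omega

lemma irrationalityExponent_xi {b : ℕ} (hb : 2 ≤ b) (θ ρ : ℝ) :
    irrationalityExponent (xi b θ ρ) = irrationalityExponent (beattySum b θ ρ) := by
  rw [← irrationalityExponent_digits hb θ ρ (d := 0) (e := (b : ℤ) - 1) (by omega), xi,
    ← tsum_mul_left]
  congr 1
  refine tsum_congr fun n => ?_
  rw [lowerSturmian_eq]
  push_cast
  ring

/-- Replacing letters by digits is an affine map; an upper Sturmian word of slope `θ` is reduced to
the slope `-θ` by `⌈x⌉ = -⌊-x⌋`. -/
lemma irrationalityExponent_of_isSturmianNumber {b : ℕ} (hb : 2 ≤ b) {θ ξ : ℝ} (h0 : 0 < θ)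
    (h1 : θ < 1) (h : IsSturmianNumber b θ ξ) :
    ∃ ρ, irrationalityExponent ξ = irrationalityExponent (beattySum b θ ρ) ∨
      irrationalityExponent ξ = irrationalityExponent (beattySum b (-θ) ρ) := by
  obtain ⟨s, d₀, d₁, ⟨ρ, -, -, hs⟩, -, -, hd, rfl⟩ := h
  have hlin : ∀ n, s n = 0 ∨ s n = 1 → (if s n = 0 then (d₀ : ℝ) else (d₁ : ℝ)) =
      (d₀ : ℤ) + ((d₁ : ℤ) - (d₀ : ℤ) : ℤ) * (s n : ℝ) := by
    intro n hn
    rcases hn with hn | hn <;> simp [hn]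
  rcases hs with rfl | rfl
  · refine ⟨ρ, Or.inl ?_⟩
    rw [← irrationalityExponent_digits hb θ ρ (d := d₀) (e := (d₁ : ℤ) - d₀) (by omega)]
    congr 1
    refine tsum_congr fun n => ?_
    rw [hlin n (lowerSturmian_eq_zero_or_one h0 h1 ρ n), lowerSturmian_eq]
  · refine ⟨-ρ, Or.inr ?_⟩
    rw [← irrationalityExponent_digits hb (-θ) (-ρ) (d := d₀) (e := -((d₁ : ℤ) - d₀)) (by omega)]
    congr 1
    refine tsum_congr fun n => ?_
    have e : upperSturmian θ ρ n = -(beatty (-θ) (-ρ) (n + 1) - beatty (-θ) (-ρ) n) := by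
      have hc : ∀ x : ℝ, ⌊x * -θ + -ρ⌋ = -⌈x * θ + ρ⌉ := fun x => by
        rw [← Int.floor_neg]; ring_nf
      unfold upperSturmian beatty
      rw [hc, hc]
      push_cast
      ring
    have h01 : upperSturmian θ ρ n = 0 ∨ upperSturmian θ ρ n = 1 := by
      obtain ⟨a1, a2⟩ := beatty_bounds (-θ) (-ρ) n
      obtain ⟨b1, b2⟩ := beatty_bounds (-θ) (-ρ) (n + 1)
      rw [e]
      push_cast at b1 b2
      have c1 : (beatty (-θ) (-ρ) (n + 1) : ℝ) < beatty (-θ) (-ρ) n + 1 := by linarith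
      have c2 : (beatty (-θ) (-ρ) n : ℝ) < beatty (-θ) (-ρ) (n + 1) + 2 := by linarith
      have c1' : beatty (-θ) (-ρ) (n + 1) < beatty (-θ) (-ρ) n + 1 := by exact_mod_cast c1
      have c2' : beatty (-θ) (-ρ) n < beatty (-θ) (-ρ) (n + 1) + 2 := by exact_mod_cast c2
      omega
    rw [hlin n h01, e]
    push_cast
    ring

/-- The positions `⌊j / θ⌋` are those at which `⌊n θ⌋` jumps, so `ξ_b(θ)` is `b` times the number
`ξ_b(θ, 0)`. -/
lemma xiChar_eq {b : ℕ} (hb : 2 ≤ b) {θ : ℝ} (hirr : Irrational θ) (h0 : 0 < θ) (h1 : θ < 1) :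
    xiChar b θ = b * xi b θ 0 := by
  have hb0 : (0 : ℝ) < b := by exact_mod_cast (by omega : 0 < b)
  have hne : ∀ (n k : ℕ), 1 ≤ k → (n : ℝ) * θ ≠ k := by
    intro n k hk hc
    have hk0 : (k : ℝ) ≠ 0 := by exact_mod_cast (by omega : k ≠ 0)
    have hn : n ≠ 0 := by
      rintro rfl
      simp at hc
      exact hk0 hc.symm
    exact (hirr.natCast_mul hn).ne_nat k hc
  have h01 := lowerSturmian_eq_zero_or_one h0 h1 0
  set g : ℕ → ℕ := fun j => ⌊((j : ℝ) + 1) / θ⌋₊ with hg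
  have hgj : ∀ j, lowerSturmian θ 0 (g j) = 1 := by
    intro j
    refine (h01 _).resolve_left fun hc => ?_
    have a1 : (g j : ℝ) ≤ ((j : ℝ) + 1) / θ := Nat.floor_le (by positivity)
    have a2 : ((j : ℝ) + 1) / θ < g j + 1 := Nat.lt_floor_add_one _
    rw [le_div_iff₀ h0] at a1
    rw [div_lt_iff₀ h0] at a2
    have a3 := hne (g j) (j + 1) (by omega)
    push_cast at a3
    have a4 := lt_of_le_of_ne a1 a3
    have b1 : ((j : ℤ) + 1) ≤ ⌊((g j : ℝ) + 1) * θ + 0⌋ := by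
      rw [Int.le_floor]; push_cast; linarith
    have b2 : ⌊(g j : ℝ) * θ + 0⌋ < (j : ℤ) + 1 := by
      rw [Int.floor_lt]; push_cast; linarith
    unfold lowerSturmian at hc
    omega
  have hinj : Function.Injective g := by
    refine StrictMono.injective (strictMono_nat_of_lt_succ fun j => ?_)
    refine Nat.lt_of_succ_le (Nat.le_floor ?_)
    have a1 : (g j : ℝ) ≤ ((j : ℝ) + 1) / θ := Nat.floor_le (by positivity)
    have a2 : 1 ≤ 1 / θ := by rw [le_div_iff₀ h0]; linarith
    push_cast
    have e : ((j : ℝ) + 1 + 1) / θ = ((j : ℝ) + 1) / θ + 1 / θ := by ring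
    rw [e]
    linarith
  have hsupp : Function.support (fun n => (lowerSturmian θ 0 n : ℝ) / (b : ℝ) ^ n) ⊆
      Set.range g := by
    intro n hn
    have hn1 : lowerSturmian θ 0 n = 1 := by
      refine (h01 n).resolve_left fun hc => hn ?_
      change (lowerSturmian θ 0 n : ℝ) / (b : ℝ) ^ n = 0
      rw [hc]; simp
    unfold lowerSturmian at hn1
    have a1 : 0 ≤ ⌊(n : ℝ) * θ + 0⌋ := Int.floor_nonneg.2 (by positivity)
    obtain ⟨j, hj⟩ := Int.eq_ofNat_of_zero_le a1
    have a2 := Int.lt_floor_add_one ((n : ℝ) * θ + 0)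
    have b1 := Int.floor_le (((n : ℝ) + 1) * θ + 0)
    have hj' : ⌊((n : ℝ) + 1) * θ + 0⌋ = (j : ℤ) + 1 := by omega
    rw [hj] at a2
    rw [hj'] at b1
    push_cast at a2 b1
    have b3 := hne (n + 1) (j + 1) (by omega)
    push_cast at b3
    refine ⟨j, ?_⟩
    rw [hg]
    refine (Nat.floor_eq_iff (by positivity)).2 ⟨?_, ?_⟩
    · rw [le_div_iff₀ h0]; linarith
    · rw [div_lt_iff₀ h0]
      exact lt_of_le_of_ne (by linarith) (Ne.symm b3)
  have hsum := hinj.tsum_eq hsupp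
  rw [xiChar, xi]
  have e1 : ∑' j : ℕ, 1 / (b : ℝ) ^ ⌊((j : ℝ) + 1) / θ⌋₊ =
      ∑' n, (lowerSturmian θ 0 n : ℝ) / (b : ℝ) ^ n := by
    rw [← hsum]
    refine tsum_congr fun j => ?_
    rw [hgj j]
    push_cast
    rfl
  have e2 : ∑' n, (lowerSturmian θ 0 n : ℝ) / (b : ℝ) ^ n =
      b * ∑' n, (lowerSturmian θ 0 n : ℝ) / (b : ℝ) ^ (n + 1) := by
    rw [← tsum_mul_left]
    refine tsum_congr fun n => ?_
    rw [pow_succ]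
    field_simp
  rw [e1, e2]
  ring

lemma irrationalityExponent_xiChar {b : ℕ} (hb : 2 ≤ b) {θ : ℝ} (hirr : Irrational θ) (h0 : 0 < θ)
    (h1 : θ < 1) : irrationalityExponent (xiChar b θ) = irrationalityExponent (beattySum b θ 0) := by
  rw [← irrationalityExponent_xi hb, xiChar_eq hb hirr h0 h1]
  have h := irrationalityExponent_affine 0 b (by exact_mod_cast (by omega : b ≠ 0)) (xi b θ 0)
  simpa using h

end SturmianSpectrum

theorem theorem2p6 (θ : ℝ) (hirr : Irrational θ) (h0 : 0 < θ) (h1 : θ < 1)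
    (hbdd : SturmianSpectrum.HasBoundedPartialQuotients θ) :
    (∀ b : ℕ, 2 ≤ b →
      SturmianSpectrum.irrationalityExponent (SturmianSpectrum.xiChar b θ) < ⊤ ∧
      SturmianSpectrum.spectrum θ ⊆
        Set.Icc (((5 / 3 + 4 * Real.sqrt 10 / 15 : ℝ)) : EReal)
          (1 + SturmianSpectrum.irrationalityExponent (SturmianSpectrum.xiChar b θ))) ∧
    ∃ ρ : ℝ, 0 ≤ ρ ∧ ρ < 1 ∧ ∀ b : ℕ, 2 ≤ b →
      SturmianSpectrum.irrationalityExponent (SturmianSpectrum.xi b θ ρ) =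
        1 + SturmianSpectrum.irrationalityExponent (SturmianSpectrum.xiChar b θ) := by
  set S := SturmianSpectrum.convergents hirr h0 h1 with hS
  obtain ⟨M, hM⟩ := SturmianSpectrum.exists_partialQuotient_le hirr h0 h1 hbdd
  obtain ⟨K, hK⟩ := S.exists_hasGrowth (M := M) fun j => hM (j + 1)
  have hK' : S.neg.HasGrowth K := hK
  have hchar : ∀ b : ℕ, 2 ≤ b →
      SturmianSpectrum.irrationalityExponent (SturmianSpectrum.xiChar b θ) =
        ((1 + K : ℝ) : EReal) := fun b hb => by
    rw [SturmianSpectrum.irrationalityExponent_xiChar hb hirr h0 h1,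
      S.irrationalityExponent_beattySum_zero hb hK]
  have hadd : (1 : EReal) + ((1 + K : ℝ) : EReal) = ((1 + 1 + K : ℝ) : EReal) := by
    rw [add_assoc 1 1 K, EReal.coe_add 1 (1 + K)]
    rfl
  refine ⟨fun b hb => ⟨?_, ?_⟩, ?_⟩
  · rw [hchar b hb]
    exact EReal.coe_lt_top _
  · rintro _ ⟨b', ξ, hb', hξ, rfl⟩
    rw [hchar b hb, hadd]
    -- The base `b'` of the Sturmian number is unrelated to `b`.
    obtain ⟨ρ, h | h⟩ := SturmianSpectrum.irrationalityExponent_of_isSturmianNumber hb' h0 h1 hξ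
    · rw [h]
      exact ⟨S.le_irrationalityExponent_beattySum hb' ρ, S.irrationalityExponent_le hb' hK ρ⟩
    · rw [h]
      exact ⟨S.neg.le_irrationalityExponent_beattySum hb' ρ,
        S.neg.irrationalityExponent_le hb' hK' ρ⟩
  · obtain ⟨ρ, hρ0, hρ1, hρ⟩ := S.exists_intercept hK
    refine ⟨ρ, hρ0, hρ1, fun b hb => ?_⟩
    rw [SturmianSpectrum.irrationalityExponent_xi hb, hρ b hb, hchar b hb, hadd]
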